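/- Consider the slow fading MIMO channel ${\bf y}[m]={\bf H}{\bf x}[m]+{\bf w}[m]$, $m=1,\dots,T$, where the random complex $n_r\times n_t$ matrix ${\bf H}$ is constant over the block and known to the receiver only, the noise entries are i.i.d. $\mathcal{CN}(0,1)$, and every codeword ${\bf X}\in\mathbb{C}^{n_t\times T}$ satisfies $\|{\bf X}\|_F^2\le T n_t\,\mathsf{SNR}$. Let $n=\min(n_r,n_t)$, let $\phi_1\le\cdots\le\phi_n$ be the ordered squared singular values of ${\bf H}$, and write $p(\mathsf{SNR})\doteq\mathsf{SNR}^{-d}$ if $p(\mathsf{SNR})>0$ for all large $\mathsf{SNR}$ and $\log p(\mathsf{SNR})/\log\mathsf{SNR}\to-d$ as $\mathsf{SNR}\to\infty$. Assume that there are real numbers $k_1<k_2<\cdots<k_n$ such that, on the polynomial scale $\epsilon_\ell=\mathsf{SNR}^{-\alpha_\ell}$, $$\mathbb{P}(\phi_1\le\epsilon_1,\dots,\phi_n\le\epsilon_n)\doteq\prod_{\ell=1}^n\min(\epsilon_\ell,1)^{k_\ell+1}=\mathsf{SNR}^{-\sum_\ell (k_\ell+1)\max(\alpha_\ell,0)}$$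 for all fixed real $\alpha_1>\alpha_2>\cdots>\alpha_n$ (that is, $\epsilon_1<\cdots<\epsilon_n$), and that the $\phi_\ell$ have exponential tails: for some $\epsilon>0$ and all large $x$, $\mathbb{P}(\phi_\ell\ge x)\le e^{-\epsilon x}$ for every $\ell$. For $s\in\{0,\dots,n-1\}$ and $s\le r<s+1$ let $$d(r)=(k_{n-s}+1)(s+1-r)+\sum_{\ell=1}^{n-s-1}(k_\ell+1).$$ Then the diversity-multiplexing tradeoff curve is $d(r)$, which is piecewise linear with $n$ segments, the $s$-th one on $[s,s+1)$: (i) the outage probability satisfies $\mathbb{P}\big(\log\det({\bf I}+\mathsf{SNR}\,{\bf H}{\bf H}^*)<r\log\mathsf{SNR}\big)\doteq\mathsf{SNR}^{-d(r)}$ if $r>0$; (ii) $d(r)$ is the largest diversity gain $d$ for which there are a block length $T\ge1$ and a family of codes, indexed by $\mathsf{SNR}$, of block length $T$ with $M(\mathsf{SNR})\ge2$ codewords, with rate $R=\frac1T\log_2M$ such that $R/\log_2\mathsf{SNR}\to r$, and with maximum likelihood error probability $\mathbb{P}_e\doteq\mathsf{SNR}^{-d}$ (averaged over equiprobable messages,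 noise and channel). Furthermore, for every integer $T\ge1$ with $T\ge k_{n-s}+1$, random Gaussian codes of block length $T$ achieve this performance: if the numbers of codewords $M(\mathsf{SNR})\ge2$ satisfy $\frac1T\log_2M(\mathsf{SNR})/\log_2\mathsf{SNR}\to r$ and all entries of all codewords are i.i.d. $\mathcal{CN}(0,\mathsf{SNR})$, then the maximum likelihood error probability averaged over this ensemble is $\doteq\mathsf{SNR}^{-d(r)}$; and there is a family of codes of this block length $T$, satisfying the power constraint, with multiplexing gain $r$ and diversity gain $d(r)$. -/

import Mathlib

open MeasureTheory ProbabilityTheory Filter Topology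
open scoped Matrix

noncomputable section

namespace MIMO

/-- Channel matrices (`nr` receive and `nt` transmit antennas), given by their entries. -/
abbrev Channel (nr nt : ℕ) : Type := Fin nr → Fin nt → ℂ

/-- Transmitted or received blocks of length `T` on `n` antennas: the entry `X i t` is the
symbol of antenna `i` at time `t`. -/
abbrev Block (n T : ℕ) : Type := Fin n → Fin T → ℂ

/-- The noiseless received block `H X`. -/
def received {nr nt T : ℕ} (H : Channel nr nt) (X : Block nt T) : Block nr T :=
  Matrix.of H * Matrix.of X

/-- Squared Frobenius norm. -/
def energy {n T : ℕ} (X : Block n T) : ℝ := ∑ i, ∑ t, ‖X i t‖ ^ 2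

/-- The `min nr nt` squared singular values of `H`, in increasing order
(`LinearMap.singularValues` lists the singular values in decreasing order). -/
def phi {nr nt : ℕ} (H : Channel nr nt) (l : Fin (min nr nt)) : ℝ :=
  (Matrix.toEuclideanLin (Matrix.of H)).singularValues (l.rev : ℕ) ^ 2

/-- `p snr ≐ snr ^ (-d)`: the quantity `p snr` is positive for large `snr`, and
`log (p snr) / log snr → -d` as `snr → ∞`. -/
def HasExponent (p : ℝ → ℝ) (d : ℝ) : Prop :=
  (∀ᶠ snr in atTop, 0 < p snr) ∧
    Tendsto (fun snr => Real.logb 2 (p snr) / Real.logb 2 snr) atTop (𝓝 (-d))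

/-- Near-zero behaviour of the ordered squared singular values under the law `μ` of the channel:
on the polynomial scale `ε_l = snr ^ (-α_l)`, for all thresholds `ε_1 < ε_2 < ⋯`,
`P(φ_l ≤ ε_l for all l) ≐ ∏_l (min ε_l 1) ^ (k_l + 1)`. -/
def NearZeroBehavior {nr nt : ℕ} (μ : Measure (Channel nr nt))
    (k : Fin (min nr nt) → ℝ) : Prop :=
  ∀ α : Fin (min nr nt) → ℝ, StrictAnti α →
    HasExponent (fun snr => μ.real {H | ∀ l, phi H l ≤ snr ^ (-α l)})
      (∑ l, (k l + 1) * max (α l) 0)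

/-- All the squared singular values have an exponential tail. -/
def ExponentialTails {nr nt : ℕ} (μ : Measure (Channel nr nt)) : Prop :=
  ∃ ε : ℝ, 0 < ε ∧ ∀ᶠ x : ℝ in atTop, ∀ l : Fin (min nr nt),
    μ.real {H | x ≤ phi H l} ≤ Real.exp (-ε * x)

/-- Probability of the outage event `log det (I + snr H H*) < r log snr`
(the determinant is a real number). -/
def outageProb {nr nt : ℕ} (μ : Measure (Channel nr nt)) (r snr : ℝ) : ℝ :=
  μ.real {H | Real.logb 2
    (1 + (snr : ℂ) • (Matrix.of H * (Matrix.of H)ᴴ)).det.re < r * Real.logb 2 snr}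

/-- The circularly symmetric complex Gaussian law `CN(0, v)`: independent real and imaginary
parts with law `N(0, v / 2)`. -/
def complexGaussian (v : NNReal) : Measure ℂ :=
  ((gaussianReal 0 (v / 2)).prod (gaussianReal 0 (v / 2))).map
    (fun p : ℝ × ℝ => (⟨p.1, p.2⟩ : ℂ))

/-- Blocks with i.i.d. `CN(0, v)` entries. -/
def gaussianBlock (n T : ℕ) (v : NNReal) : Measure (Block n T) :=
  Measure.pi fun _ => Measure.pi fun _ => complexGaussian v

/-- Maximum likelihood decoding of the received block `Y`, knowing `H`, decides for message `i`:
`X i` minimizes `‖Y - H X j‖`; ties are broken in favour of the smallest index. -/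
def MLDecides {nr nt T M : ℕ} (H : Channel nr nt) (X : Fin M → Block nt T) (Y : Block nr T)
    (i : Fin M) : Prop :=
  (∀ j, energy (Y - received H (X i)) ≤ energy (Y - received H (X j))) ∧
    ∀ j < i, energy (Y - received H (X i)) < energy (Y - received H (X j))

/-- Error probability of maximum likelihood decoding for the code `X`, averaged over equiprobable
messages, the channel, and noise with i.i.d. `CN(0, 1)` entries. -/
def errorProb {nr nt T M : ℕ} (μ : Measure (Channel nr nt)) (X : Fin M → Block nt T) : ℝ :=
  (∑ i, (μ.prod (gaussianBlock nr T 1)).real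
    {p | ¬ MLDecides p.1 X (received p.1 (X i) + p.2) i}) / M

/-- Codebook sizes `M snr ≥ 2` for block length `T` have multiplexing gain `r`: the rate
`R = log M / T` in bits per symbol satisfies `R / log snr → r`. -/
def HasMultiplexingGain (T : ℕ) (M : ℝ → ℕ) (r : ℝ) : Prop :=
  (∀ snr, 2 ≤ M snr) ∧
    Tendsto (fun snr => Real.logb 2 (M snr) / T / Real.logb 2 snr) atTop (𝓝 r)

/-- The diversity gain `d` is supported at multiplexing gain `r` by some sequence of codes of
block length `T` that satisfies the power constraint `T nt snr` on each codeword. -/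
def Supports {nr nt : ℕ} (μ : Measure (Channel nr nt)) (T : ℕ) (r d : ℝ) : Prop :=
  ∃ (M : ℝ → ℕ) (X : (snr : ℝ) → Fin (M snr) → Block nt T),
    HasMultiplexingGain T M r ∧
    (∀ snr, 0 < snr → ∀ i, energy (X snr i) ≤ T * nt * snr) ∧
    HasExponent (fun snr => errorProb μ (X snr)) d

/-- Error probability of a random Gaussian code with `M` codewords of block length `T`: the mean
of `errorProb` when all the entries of all the codewords are i.i.d. `CN(0, snr)`. -/
def gaussianCodeErrorProb {nr nt : ℕ} (μ : Measure (Channel nr nt)) (T M : ℕ) (snr : ℝ) : ℝ :=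
  ∫ X : Fin M → Block nt T, errorProb μ X ∂(Measure.pi fun _ => gaussianBlock nt T snr.toNNReal)

/-- The `s`-th linear piece of the tradeoff curve (for `s ≤ r < s + 1`). With
`n = min nr nt` and `k` indexed by `1, …, n`, it is
`(k_(n-s) + 1) (s + 1 - r) + ∑_(l < n - s) (k_l + 1)`. -/
def segment {n : ℕ} (k : Fin n → ℝ) (s : Fin n) (r : ℝ) : ℝ :=
  (k s.rev + 1) * ((s : ℝ) + 1 - r) + ∑ l ∈ Finset.Iio s.rev, (k l + 1)

end MIMO

end

namespace MIMO

/-! ### Densities of the Gaussian laws -/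

/-! Write `φ_l = snr ^ (-α_l)`. Such a channel has probability of exponent `∑ (k_l + 1) max(α_l,
0)`, and `log det` of it is about `∑ max(1 - α_l, 0)` times `log snr`. Hence everything is governed
by one linear programme: minimize the first sum while the second stays below `r`. As the costs `k_l
+ 1` increase with `l`, it is cheapest to ruin the weak directions: the strongest `s` keep full
gain, the next one keeps `r - s`, the others keep none. The cost is `segment k s r`. The lower bound
on the cost is weak duality with multiplier `K = k_{n-s} + 1` (`segment_le`); near-optimal points
are given by `exists_scale`.

Upper bounds on probabilities. Let `f ≤ 1` be a function of the channel with `f ≤ snr ^ (τ (r + δ₀))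
/ ∏ (1 + snr φ_l / 16) ^ τ` and `τ ≥ K`. Cutting the exponents `α_l` into a finite grid and applying
duality in each cell gives a mean of `f` at most `snr ^ (-segment k s r + δ)`
(`eventually_lintegral_le`). For outage, `f` is the indicator of the event and `τ` is free. For
codes, `f` is the ensemble-averaged union bound and `τ = T`, whence the condition on the block
length (`eventually_lintegral_errorProb_le`). To meet the power constraint, a Gaussian law of
smaller variance is conditioned on it; this at most doubles the law, and some code does no worse
than the mean.

Lower bounds. On the box `φ_l ≤ snr ^ (-α_l)` given by `exists_scale`, outage is immediate if `r >
0`. For codes, the noiseless received words fall into far fewer than `M` clusters of bounded radius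
(`exists_clusters`). Moving a Gaussian mean within a cluster costs a bounded factor, and the
decision regions are disjoint, so each cluster supports a bounded number of messages
(`one_le_condError_add`) and the error is at least `1/8`. If `r = 0`, the scale has all `α_l > 1`:
all received words merge and two messages are already too many. The resulting bound is uniform over
codes (`eventually_rpow_le_errorProb`), so it serves constrained codes and random ones alike. -/

theorem lintegral_pi_prod {E : Type*} [MeasurableSpace E] :
    ∀ {n : ℕ} (μ : Fin n → Measure E) [∀ i, SigmaFinite (μ i)] (f : Fin n → E → ENNReal),
      (∀ i, Measurable (f i)) →
      ∫⁻ x, ∏ i, f i (x i) ∂(Measure.pi μ) = ∏ i, ∫⁻ x, f i x ∂(μ i)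
  | 0, μ, _, f, hf => by
      simp only [Finset.univ_eq_empty, Finset.prod_empty, lintegral_const, one_mul]
      simp
  | n + 1, μ, _, f, hf => by
      have h := (measurePreserving_piFinSuccAbove μ 0).symm
      rw [← h.lintegral_comp (by fun_prop)]
      simp only [Fin.prod_univ_succ, MeasurableEquiv.piFinSuccAbove_symm_apply,
        Fin.insertNthEquiv, Equiv.coe_fn_mk, Fin.insertNth_zero', Fin.cons_zero, Fin.cons_succ]
      rw [lintegral_prod_mul (f := f 0) (g := fun y : Fin n → E => ∏ i, f i.succ (y i))
        (hf 0).aemeasurable (Finset.measurable_prod _ fun i _ =>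
          (hf i.succ).comp (measurable_pi_apply i)).aemeasurable]
      congr 1
      simpa using lintegral_pi_prod (fun i : Fin n => μ i.succ) (fun i => f i.succ)
        (fun i => hf _)

theorem pi_withDensity {E : Type*} [MeasurableSpace E] {n : ℕ} (μ : Fin n → Measure E)
    [∀ i, SigmaFinite (μ i)] (f : Fin n → E → ENNReal) (hf : ∀ i, Measurable (f i))
    [∀ i, SigmaFinite ((μ i).withDensity (f i))] :
    Measure.pi (fun i => (μ i).withDensity (f i)) =
      (Measure.pi μ).withDensity (fun x => ∏ i, f i (x i)) := by
  refine Measure.pi_eq fun s hs => ?_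
  rw [withDensity_apply _ (MeasurableSet.univ_pi hs),
      ← lintegral_indicator (MeasurableSet.univ_pi hs)]
  have h1 : (Set.univ.pi s).indicator (fun x : Fin n → E => ∏ i, f i (x i)) =
      fun x => ∏ i, (s i).indicator (f i) (x i) := by
    classical
    ext x
    by_cases hx : ∀ i, x i ∈ s i
    · rw [Set.indicator_of_mem (by simpa using hx)]
      exact Finset.prod_congr rfl fun i _ => by rw [Set.indicator_of_mem (hx i)]
    · rw [Set.indicator_of_notMem (by simpa using hx)]
      push Not at hx
      obtain ⟨i, hi⟩ := hx
      exact (Finset.prod_eq_zero (Finset.mem_univ i) (Set.indicator_of_notMem hi _)).symm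
  rw [h1, lintegral_pi_prod μ _ fun i => (hf i).indicator (hs i)]
  exact Finset.prod_congr rfl fun i _ => by
    rw [lintegral_indicator (hs i), withDensity_apply _ (hs i)]

instance (v : NNReal) : IsProbabilityMeasure (complexGaussian v) := by
  unfold complexGaussian
  refine Measure.isProbabilityMeasure_map ?_
  exact Complex.measurableEquivRealProd.symm.measurable.aemeasurable

instance (n T : ℕ) (v : NNReal) : IsProbabilityMeasure (gaussianBlock n T v) := by
  unfold gaussianBlock; infer_instance

theorem complexGaussian_eq_withDensity {v : NNReal} (hv : v ≠ 0) :
    complexGaussian v =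
      volume.withDensity
        (fun z : ℂ => ENNReal.ofReal ((Real.pi * v)⁻¹ * Real.exp (-‖z‖ ^ 2 / v))) := by
  have hv2 : v / 2 ≠ 0 := by simpa using hv
  have hv0 : (0 : ℝ) < v := by positivity
  have hm : Measurable (fun p : ℝ × ℝ => (⟨p.1, p.2⟩ : ℂ)) :=
    Complex.measurableEquivRealProd.symm.measurable
  have hmp : MeasurePreserving (fun p : ℝ × ℝ => (⟨p.1, p.2⟩ : ℂ)) volume volume :=
    Complex.volume_preserving_equiv_real_prod.symm
  ext A hA
  rw [complexGaussian, gaussianReal_of_var_ne_zero _ hv2,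
    prod_withDensity (measurable_gaussianPDF _ _) (measurable_gaussianPDF _ _),
    Measure.map_apply hm hA, withDensity_apply _ (hm hA), withDensity_apply _ hA,
    ← lintegral_indicator (hm hA), ← lintegral_indicator hA, ← hmp.lintegral_comp
      (Measurable.indicator (by fun_prop) hA)]
  change ∫⁻ a : ℝ × ℝ, _ ∂volume = _
  refine lintegral_congr fun p => ?_
  by_cases hp : (⟨p.1, p.2⟩ : ℂ) ∈ A
  · rw [Set.indicator_of_mem hp, Set.indicator_of_mem (s := (fun p : ℝ × ℝ => (⟨p.1,
      p.2⟩ : ℂ)) ⁻¹' A) hp]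
    simp only [gaussianPDF, gaussianPDFReal]
    rw [← ENNReal.ofReal_mul (by positivity)]
    congr 1
    have h1 : ‖(⟨p.1, p.2⟩ : ℂ)‖ ^ 2 = p.1 ^ 2 + p.2 ^ 2 := by
      rw [Complex.sq_norm, Complex.normSq_mk]; ring
    have h2 : (√(2 * Real.pi * ((v / 2 : NNReal) : ℝ)))⁻¹ *
        (√(2 * Real.pi * ((v / 2 : NNReal) : ℝ)))⁻¹
        = (Real.pi * v)⁻¹ := by
      rw [← mul_inv, Real.mul_self_sqrt (by positivity)]
      push_cast; congr 1; ring
    rw [h1, mul_mul_mul_comm, h2, ← Real.exp_add]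
    congr 2
    push_cast
    field_simp
    ring
  · rw [Set.indicator_of_notMem hp, Set.indicator_of_notMem (s := (fun p : ℝ × ℝ => (⟨p.1,
      p.2⟩ : ℂ)) ⁻¹' A) hp]

theorem continuous_energy {n T : ℕ} : Continuous (energy : Block n T → ℝ) := by
  unfold energy; fun_prop

@[fun_prop]
theorem measurable_energy {n T : ℕ} : Measurable (energy : Block n T → ℝ) :=
  continuous_energy.measurable

theorem gaussianBlock_eq_withDensity {n T : ℕ} {v : NNReal} (hv : v ≠ 0) :
    gaussianBlock n T v =
      volume.withDensity
        (fun X : Block n T =>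
          ENNReal.ofReal ((Real.pi * v)⁻¹ ^ (n * T) * Real.exp (-energy X / v))) := by
  have hv0 : (0 : ℝ) < v := by positivity
  have hd : Measurable
      (fun z : ℂ => ENNReal.ofReal ((Real.pi * v)⁻¹ * Real.exp (-‖z‖ ^ 2 / v))) := by fun_prop
  have i1 : IsProbabilityMeasure ((volume : Measure ℂ).withDensity
      (fun z : ℂ => ENNReal.ofReal ((Real.pi * v)⁻¹ * Real.exp (-‖z‖ ^ 2 / v)))) := by
    rw [← complexGaussian_eq_withDensity hv]; infer_instance
  have h1 : (Measure.pi fun _ : Fin T => complexGaussian v) =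
      volume.withDensity (fun x : Fin T → ℂ =>
        ∏ t, ENNReal.ofReal ((Real.pi * v)⁻¹ * Real.exp (-‖x t‖ ^ 2 / v))) := by
    rw [complexGaussian_eq_withDensity hv, pi_withDensity _ _ fun _ => hd]; rfl
  have i2 : IsProbabilityMeasure ((volume : Measure (Fin T → ℂ)).withDensity
      (fun x : Fin T → ℂ =>
        ∏ t, ENNReal.ofReal ((Real.pi * v)⁻¹ * Real.exp (-‖x t‖ ^ 2 / v)))) := by
    rw [← h1]; infer_instance
  rw [gaussianBlock, h1, pi_withDensity _ _ fun _ => by fun_prop]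
  change volume.withDensity _ = _
  congr 1
  ext X
  rw [Finset.prod_congr rfl fun i _ => (ENNReal.ofReal_prod_of_nonneg
      (fun t _ => (by positivity : 0 ≤ (Real.pi * v : ℝ)⁻¹ * Real.exp (-‖X i t‖ ^ 2 / v)))).symm,
    ← ENNReal.ofReal_prod_of_nonneg (fun i _ => Finset.prod_nonneg fun t _ => by positivity)]
  congr 1
  simp only [Finset.prod_mul_distrib, Finset.prod_const, Finset.card_univ, Fintype.card_fin,
    ← Real.exp_sum, energy]
  rw [← pow_mul, mul_comm T n]
  simp only [neg_div, Finset.sum_neg_distrib, Finset.sum_div]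

/-! ### Isometries, tails and shifts of Gaussian blocks -/

theorem sq_norm_le_energy {n T : ℕ} (X : Block n T) (i : Fin n) (t : Fin T) :
    ‖X i t‖ ^ 2 ≤ energy X :=
  (Finset.single_le_sum (f := fun t => ‖X i t‖ ^ 2) (fun _ _ => by positivity)
    (Finset.mem_univ t)).trans
  (Finset.single_le_sum (f := fun i => ∑ t, ‖X i t‖ ^ 2) (fun _ _ => by positivity)
    (Finset.mem_univ i))

theorem energy_eq_zero {n T : ℕ} {X : Block n T} (h : energy X = 0) : X = 0 := by
  ext i t
  have := sq_norm_le_energy X i t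
  rw [h] at this
  have h2 : ‖X i t‖ = 0 := by nlinarith [norm_nonneg (X i t)]
  simpa using h2

@[simp]
theorem energy_zero {n T : ℕ} : energy (0 : Block n T) = 0 := by simp [energy]

@[simp]
theorem energy_neg {n T : ℕ} (X : Block n T) : energy (-X) = energy X := by simp [energy]

theorem energy_add_le {n T : ℕ} (X Y : Block n T) {a : ℝ} (ha : 0 < a) :
    energy (X + Y) ≤ (1 + a) * energy X + (1 + a⁻¹) * energy Y := by
  unfold energy
  simp only [Finset.mul_sum, ← Finset.sum_add_distrib]
  refine Finset.sum_le_sum fun i _ => Finset.sum_le_sum fun t _ => ?_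
  have h1 : ‖(X + Y) i t‖ ≤ ‖X i t‖ + ‖Y i t‖ := norm_add_le _ _
  have h2 : ‖(X + Y) i t‖ ^ 2 ≤ (‖X i t‖ + ‖Y i t‖) ^ 2 := by gcongr
  have h3 : 0 ≤ a⁻¹ * (a * ‖X i t‖ - ‖Y i t‖) ^ 2 := by positivity
  have h4 : a⁻¹ * (a * ‖X i t‖ - ‖Y i t‖) ^ 2 =
      a * ‖X i t‖ ^ 2 - 2 * ‖X i t‖ * ‖Y i t‖ + a⁻¹ * ‖Y i t‖ ^ 2 := by
    field_simp
    ring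
  nlinarith

instance (n T : ℕ) : (volume : Measure (Block n T)).IsAddHaarMeasure :=
  Measure.pi.isAddHaarMeasure fun _ : Fin n => (volume : Measure (Fin T → ℂ))

/-- A linear map multiplies Haar measure by a constant. The energy ball is its own preimage and has
finite positive volume, so the constant is 1. -/
theorem measurePreserving_volume_of_energy {n T : ℕ} (A : Block n T →ₗ[ℝ] Block n T)
    (hA : ∀ X, energy (A X) = energy X) : MeasurePreserving A volume volume := by
  have hc : Continuous A := A.continuous_of_finiteDimensional
  have hinj : Function.Injective A := by
    refine (injective_iff_map_eq_zero A).2 fun X hX => energy_eq_zero ?_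
    rw [← hA, hX, energy_zero]
  have hdet : LinearMap.det A ≠ 0 := by
    have := (LinearEquiv.ofInjectiveEndo A hinj).isUnit_det'
    exact this.ne_zero
  have hmap := Measure.map_linearMap_addHaar_eq_smul_addHaar (volume : Measure (Block n T)) hdet
  have hopen : IsOpen {X : Block n T | energy X < 1} :=
    isOpen_lt continuous_energy continuous_const
  have hpos : volume {X : Block n T | energy X < 1} ≠ 0 :=
    (hopen.measure_pos volume ⟨0, by simp⟩).ne'
  have hfin : volume {X : Block n T | energy X < 1} ≠ ⊤ := by
    refine ((Metric.isBounded_closedBall (x := (0 : Block n T)) (r := 1)).subset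
      fun X hX => ?_).measure_lt_top.ne
    rw [mem_closedBall_zero_iff, pi_norm_le_iff_of_nonneg zero_le_one]
    intro i
    rw [pi_norm_le_iff_of_nonneg zero_le_one]
    intro t
    have := sq_norm_le_energy X i t
    have hX : energy X < 1 := hX
    nlinarith [norm_nonneg (X i t)]
  have h1 : Measure.map A volume {X : Block n T | energy X < 1} =
      volume {X : Block n T | energy X < 1} := by
    rw [Measure.map_apply hc.measurable hopen.measurableSet]
    simp [Set.preimage, hA]
  refine ⟨hc.measurable, ?_⟩
  rw [hmap] at h1 ⊢
  rw [Measure.smul_apply, smul_eq_mul] at h1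
  have : ENNReal.ofReal |(LinearMap.det A)⁻¹| = 1 := by
    have h2 : ENNReal.ofReal |(LinearMap.det A)⁻¹| * volume {X : Block n T | energy X < 1} =
      1 * volume {X : Block n T | energy X < 1} := by rw [h1, one_mul]
    exact (ENNReal.mul_left_inj hpos hfin).1 h2
  rw [this, one_smul]

theorem lintegral_gaussianBlock {n T : ℕ} {v : NNReal} (hv : v ≠ 0) {f : Block n T → ENNReal}
    (hf : Measurable f) :
    ∫⁻ X, f X ∂(gaussianBlock n T v) = ∫⁻ X, ENNReal.ofReal
      ((Real.pi * v)⁻¹ ^ (n * T) * Real.exp (-energy X / v)) * f X := by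
  rw [gaussianBlock_eq_withDensity hv,
    lintegral_withDensity_eq_lintegral_mul _ (by fun_prop) hf]
  rfl

theorem lintegral_gaussian_density {n T : ℕ} {v : NNReal} (hv : v ≠ 0) :
    ∫⁻ X : Block n T, ENNReal.ofReal
      ((Real.pi * v)⁻¹ ^ (n * T) * Real.exp (-energy X / v)) = 1 := by
  have := lintegral_gaussianBlock (n := n) (T := T) hv (f := fun _ => 1) measurable_const
  simpa using this.symm

/-- The density depends on the energy alone. This allows the unitary matrix that diagonalizes the
channel to be absorbed into a Gaussian codeword. -/
theorem measurePreserving_gaussianBlock_of_energy {n T : ℕ} {v : NNReal} (hv : v ≠ 0)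
    (A : Block n T →ₗ[ℝ] Block n T) (hA : ∀ X, energy (A X) = energy X) :
    MeasurePreserving A (gaussianBlock n T v) (gaussianBlock n T v) := by
  have h := measurePreserving_volume_of_energy A hA
  refine ⟨h.measurable, Measure.ext_of_lintegral _ fun f hf => ?_⟩
  rw [lintegral_map hf h.measurable, lintegral_gaussianBlock hv (f :=
      fun X => f (A X)) (hf.comp h.measurable),
    lintegral_gaussianBlock hv hf, ← h.lintegral_comp (f := fun X => ENNReal.ofReal
      ((Real.pi * v)⁻¹ ^ (n * T) * Real.exp (-energy X / v)) * f X) (by fun_prop)]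
  simp only [hA]

/-- Comparison with variance `2 v`: the ratio of the two densities is `2 ^ (n T) exp (-energy X / (2
v))`, which is bounded on the event by its value at energy `y`. -/
theorem gaussianBlock_energy_tail {n T : ℕ} {v : NNReal} (hv : v ≠ 0) (y : ℝ) :
    gaussianBlock n T v {X | y ≤ energy X} ≤
      ENNReal.ofReal (2 ^ (n * T) * Real.exp (-y / (2 * v))) := by
  have hv0 : (0 : ℝ) < v := by positivity
  have hS : MeasurableSet {X : Block n T | y ≤ energy X} :=
    measurableSet_le measurable_const measurable_energy
  rw [← lintegral_indicator_one hS,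
    lintegral_gaussianBlock hv (measurable_one.indicator hS)]
  calc _ ≤ ∫⁻ X : Block n T, ENNReal.ofReal (2 ^ (n * T) * Real.exp (-y / (2 * v))) *
        ENNReal.ofReal ((Real.pi * (2 * v : NNReal))⁻¹ ^ (n * T) *
          Real.exp (-energy X / (2 * v : NNReal))) := by
        refine lintegral_mono fun X => ?_
        by_cases hX : y ≤ energy X
        · rw [Set.indicator_of_mem (by exact hX), Pi.one_apply, mul_one,
            ← ENNReal.ofReal_mul (by positivity)]
          refine ENNReal.ofReal_le_ofReal ?_
          rw [mul_mul_mul_comm, ← Real.exp_add, ← mul_pow]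
          have h1 : (2 : ℝ) * (Real.pi * (2 * v : NNReal))⁻¹ = (Real.pi * v)⁻¹ := by
            push_cast; field_simp
          rw [h1]
          gcongr
          push_cast
          rw [← add_div, div_le_div_iff₀ hv0 (by positivity)]
          nlinarith
        · rw [Set.indicator_of_notMem (by exact hX)]; simp
    _ = _ := by
        rw [lintegral_const_mul _ (by fun_prop),
          lintegral_gaussian_density (by positivity), mul_one]

/-- By the parallelogram identity at the midpoint (`key`), on the event `energy W ≥ energy (W + V /
2) + energy V / 4`. So the density is at most `exp (-energy V / 4)` times a translated Gaussian
density, of mass one. -/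
theorem gaussianBlock_pairwise_error {n T : ℕ} (V : Block n T) :
    gaussianBlock n T 1 {W | energy (W + V) ≤ energy W} ≤
      ENNReal.ofReal (Real.exp (-energy V / 4)) := by
  have hS : MeasurableSet {W : Block n T | energy (W + V) ≤ energy W} :=
    measurableSet_le (by fun_prop) measurable_energy
  rw [← lintegral_indicator_one hS,
    lintegral_gaussianBlock one_ne_zero (measurable_one.indicator hS)]
  have key : ∀ W : Block n T, energy (W + (2⁻¹ : ℝ) • V) =
      energy W / 2 + energy (W + V) / 2 - energy V / 4 := by
    intro W
    unfold energy
    simp only [Finset.sum_div, ← Finset.sum_add_distrib, ← Finset.sum_sub_distrib]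
    refine Finset.sum_congr rfl fun i _ => Finset.sum_congr rfl fun t _ => ?_
    simp only [Pi.add_apply, Pi.smul_apply, Complex.sq_norm, Complex.normSq_apply,
      Complex.add_re, Complex.add_im, Complex.real_smul, Complex.mul_re, Complex.mul_im,
      Complex.ofReal_re, Complex.ofReal_im]
    ring
  calc _ ≤ ∫⁻ W : Block n T, ENNReal.ofReal (Real.exp (-energy V / 4)) *
        ENNReal.ofReal ((Real.pi * (1 : NNReal))⁻¹ ^ (n * T) *
          Real.exp (-energy (W + (2⁻¹ : ℝ) • V) / (1 : NNReal))) := by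
        refine lintegral_mono fun W => ?_
        by_cases hW : energy (W + V) ≤ energy W
        · rw [Set.indicator_of_mem (by exact hW), Pi.one_apply, mul_one,
            ← ENNReal.ofReal_mul (by positivity)]
          refine ENNReal.ofReal_le_ofReal ?_
          rw [mul_left_comm, ← Real.exp_add, key W]
          gcongr
          simp only [NNReal.coe_one, div_one]
          linarith
        · rw [Set.indicator_of_notMem (by exact hW)]; simp
    _ = _ := by
        rw [lintegral_const_mul _ (by fun_prop),
          lintegral_add_right_eq_self (μ := (volume : Measure (Block n T))) (fun W =>
            ENNReal.ofReal ((Real.pi * (1 : NNReal))⁻¹ ^ (n * T) *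
              Real.exp (-energy W / (1 : NNReal)))),
          lintegral_gaussian_density one_ne_zero, mul_one]

/-- Moving the mean of a Gaussian block by at most `κ` changes the probability of an event by at
most a bounded factor, up to the event that the noise is large. -/
theorem gaussianBlock_shift_le {n T : ℕ} {D : Set (Block n T)} (hD : MeasurableSet D)
    (c c' : Block n T) {κ R : ℝ} (hκ : 0 < κ) (hc : energy (c - c') ≤ κ ^ 2) :
    gaussianBlock n T 1 {W | c + W ∈ D} ≤ gaussianBlock n T 1 {W | R ≤ energy W} +
      ENNReal.ofReal (Real.exp (κ * R + κ + κ ^ 2)) * gaussianBlock n T 1 {W | c' + W ∈ D} := by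
  have hm : ∀ b : Block n T, MeasurableSet {W | b + W ∈ D} := fun b =>
    hD.preimage (by fun_prop)
  have hE : MeasurableSet {W : Block n T | energy W < R} :=
    measurableSet_lt measurable_energy measurable_const
  have hsub : {W | c + W ∈ D} ⊆ {W | R ≤ energy W} ∪ ({W | c + W ∈ D} ∩ {W | energy W < R}) := by
    intro W hW
    by_cases h : R ≤ energy W
    · exact Or.inl h
    · exact Or.inr ⟨hW, not_le.1 h⟩
  refine (measure_mono hsub).trans ((measure_union_le _ _).trans ?_)
  gcongr
  rw [← lintegral_indicator_one ((hm c).inter hE), ← lintegral_indicator_one (hm c'),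
    lintegral_gaussianBlock one_ne_zero (measurable_one.indicator ((hm c).inter hE)),
    lintegral_gaussianBlock one_ne_zero (measurable_one.indicator (hm c')),
    ← lintegral_add_right_eq_self (μ := (volume : Measure (Block n T)))
      (fun W => ENNReal.ofReal ((Real.pi * (1 : NNReal))⁻¹ ^ (n * T) *
        Real.exp (-energy W / (1 : NNReal))) * {W | c' + W ∈ D}.indicator 1 W) (c - c'),
    ← lintegral_const_mul _ (by
      refine Measurable.mul (by fun_prop) ?_
      exact (measurable_one.indicator (hm c')).comp
        (measurable_id.add_const (c - c') : Measurable fun W : Block n T => W + (c - c')))]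
  refine lintegral_mono fun W => ?_
  by_cases hW : W ∈ {W | c + W ∈ D} ∩ {W | energy W < R}
  · have h1 : W + (c - c') ∈ {W | c' + W ∈ D} := by
      have : c' + (W + (c - c')) = c + W := by abel
      simpa [this] using hW.1
    rw [Set.indicator_of_mem hW, Set.indicator_of_mem h1]
    simp only [Pi.one_apply, mul_one]
    rw [← ENNReal.ofReal_mul (by positivity)]
    refine ENNReal.ofReal_le_ofReal ?_
    rw [mul_left_comm, ← Real.exp_add]
    gcongr
    -- With parameter `κ`, the shifted energy exceeds `energy W` by at most `κ R + κ + κ ^ 2`, which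
    -- is the exponent in the statement.
    have h2 := energy_add_le W (c - c') hκ
    have h3 : energy W < R := hW.2
    have h4 : (1 + κ⁻¹) * energy (c - c') ≤ (1 + κ⁻¹) * κ ^ 2 := by gcongr
    have h5 : (1 + κ⁻¹) * κ ^ 2 = κ ^ 2 + κ := by field_simp
    simp only [NNReal.coe_one, div_one]
    nlinarith
  · rw [Set.indicator_of_notMem hW]; simp

theorem lintegral_exp_sq_complex {b : ℝ} (hb : 0 < b) (m : ℂ) :
    ∫⁻ z : ℂ, ENNReal.ofReal (Real.exp (-(b * ‖z - m‖ ^ 2))) = ENNReal.ofReal (Real.pi / b) := by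
  have h0 : (Real.toNNReal b⁻¹) ≠ 0 := by simpa using hb
  have h1 : complexGaussian (Real.toNNReal b⁻¹) Set.univ = 1 := measure_univ
  rw [complexGaussian_eq_withDensity h0, withDensity_apply _ MeasurableSet.univ,
    Measure.restrict_univ] at h1
  have h2 : (Real.pi * b⁻¹)⁻¹ = b / Real.pi := by field_simp
  have hc : (Real.toNNReal b⁻¹ : ℝ) = b⁻¹ := Real.coe_toNNReal _ (by positivity)
  simp only [hc, h2] at h1
  rw [lintegral_sub_right_eq_self (fun z : ℂ => ENNReal.ofReal (Real.exp (-(b * ‖z‖ ^ 2))))]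
  simp only [ENNReal.ofReal_mul (show 0 ≤ b / Real.pi by positivity)] at h1
  rw [lintegral_const_mul _ (by fun_prop)] at h1
  have h3 : ∀ z : ℂ, -‖z‖ ^ 2 / b⁻¹ = -(b * ‖z‖ ^ 2) := fun z => by
    rw [div_inv_eq_mul]; ring
  simp only [h3] at h1
  calc _ = ENNReal.ofReal (Real.pi / b) * (ENNReal.ofReal (b / Real.pi) *
        ∫⁻ z : ℂ, ENNReal.ofReal (Real.exp (-(b * ‖z‖ ^ 2)))) := by
        rw [← mul_assoc, ← ENNReal.ofReal_mul (by positivity)]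
        rw [show Real.pi / b * (b / Real.pi) = 1 by field_simp]
        simp
    _ = _ := by rw [h1, mul_one]

/-- Completing the square around `m = c v / (1 + c v) * y` leaves the nonnegative remainder `c / (1
+ c v) * ‖y‖ ^ 2`. Dropping it makes the bound uniform in `y`. -/
theorem lintegral_exp_complexGaussian_le {v : NNReal} (hv : v ≠ 0) {c : ℝ} (hc : 0 ≤ c) (y : ℂ) :
    ∫⁻ z, ENNReal.ofReal (Real.exp (-(c * ‖z - y‖ ^ 2))) ∂(complexGaussian v) ≤
      ENNReal.ofReal (1 + c * v)⁻¹ := by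
  have hv0 : (0 : ℝ) < v := by positivity
  rw [complexGaussian_eq_withDensity hv,
    lintegral_withDensity_eq_lintegral_mul _ (by fun_prop) (by fun_prop)]
  set m : ℂ := ((c * v / (1 + c * v) : ℝ) : ℂ) * y with hm
  have hb : 0 < 1 / (v : ℝ) + c := by positivity
  calc _ ≤ ∫⁻ z : ℂ, ENNReal.ofReal (Real.pi * v)⁻¹ *
        ENNReal.ofReal (Real.exp (-((1 / (v : ℝ) + c) * ‖z - m‖ ^ 2))) := by
        refine lintegral_mono fun z => ?_
        simp only [Pi.mul_apply]
        rw [← ENNReal.ofReal_mul (by positivity), ← ENNReal.ofReal_mul (by positivity)]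
        refine ENNReal.ofReal_le_ofReal ?_
        rw [mul_assoc, ← Real.exp_add]
        gcongr
        have key : ‖z‖ ^ 2 / v + c * ‖z - y‖ ^ 2 =
            (1 / (v : ℝ) + c) * ‖z - m‖ ^ 2 + c / (1 + c * v) * ‖y‖ ^ 2 := by
          have hne : (1 + c * v : ℝ) ≠ 0 := by positivity
          simp only [hm, Complex.sq_norm, Complex.normSq_apply, Complex.sub_re, Complex.sub_im,
            Complex.mul_re, Complex.mul_im, Complex.ofReal_re, Complex.ofReal_im]
          field_simp
          ring
        have : 0 ≤ c / (1 + c * v) * ‖y‖ ^ 2 := by positivity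
        rw [neg_div]
        linarith
    _ = _ := by
        rw [lintegral_const_mul _ (by fun_prop), lintegral_exp_sq_complex hb,
          ← ENNReal.ofReal_mul (by positivity)]
        congr 1
        field_simp

theorem lintegral_exp_gaussianBlock_le {n T : ℕ} {v : NNReal} (hv : v ≠ 0) {c : ℝ} (hc : 0 ≤ c)
    {lam : Fin n → ℝ} (hlam : ∀ i, 0 ≤ lam i) (y : Block n T) :
    ∫⁻ X, ENNReal.ofReal (Real.exp (-(c * ∑ i, lam i * ∑ t, ‖X i t - y i t‖ ^ 2)))
      ∂(gaussianBlock n T v) ≤ ENNReal.ofReal ((∏ i, (1 + c * v * lam i)) ^ T)⁻¹ := by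
  have h1 : ∀ X : Block n T,
      ENNReal.ofReal (Real.exp (-(c * ∑ i, lam i * ∑ t, ‖X i t - y i t‖ ^ 2))) =
        ∏ i, ∏ t, ENNReal.ofReal (Real.exp (-((c * lam i) * ‖X i t - y i t‖ ^ 2))) := by
    intro X
    rw [Finset.prod_congr rfl fun i _ => (ENNReal.ofReal_prod_of_nonneg
      (fun t _ => (Real.exp_pos (-((c * lam i) * ‖X i t - y i t‖ ^ 2))).le)).symm,
      ← ENNReal.ofReal_prod_of_nonneg (fun i _ => Finset.prod_nonneg fun t _ =>
        (Real.exp_pos _).le)]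
    simp only [← Real.exp_sum, Finset.mul_sum, Finset.sum_neg_distrib, mul_assoc]
  simp only [h1]
  unfold gaussianBlock
  rw [lintegral_pi_prod _ (fun i (x : Fin T → ℂ) =>
    ∏ t, ENNReal.ofReal (Real.exp (-((c * lam i) * ‖x t - y i t‖ ^ 2)))) (fun i => by fun_prop)]
  rw [← Finset.prod_pow, ← Finset.prod_inv_distrib, ENNReal.ofReal_prod_of_nonneg
    (fun i _ => by have := hlam i; positivity)]
  refine Finset.prod_le_prod' fun i _ => ?_
  rw [lintegral_pi_prod _ (fun t (z : ℂ) =>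
    ENNReal.ofReal (Real.exp (-((c * lam i) * ‖z - y i t‖ ^ 2)))) (fun t => by fun_prop)]
  have hl := hlam i
  calc _ ≤ ∏ t : Fin T, ENNReal.ofReal (1 + c * lam i * v)⁻¹ :=
        Finset.prod_le_prod' fun t _ => lintegral_exp_complexGaussian_le hv (by positivity) _
    _ = _ := by
        rw [Finset.prod_const, Finset.card_univ, Fintype.card_fin,
          ← ENNReal.ofReal_pow (by positivity), inv_pow]
        congr 4
        ring

/-! ### Spectral decomposition of the channel -/

theorem phi_nonneg {nr nt : ℕ} (H : Channel nr nt) (l : Fin (min nr nt)) : 0 ≤ phi H l :=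
  sq_nonneg _

theorem phi_monotone {nr nt : ℕ} (H : Channel nr nt) : Monotone (phi H) := by
  intro l l' h
  have h1 := (Matrix.toEuclideanLin (Matrix.of H)).singularValues_antitone
    (show (l'.rev : ℕ) ≤ l.rev from Fin.rev_le_rev.2 h)
  have h2 := (Matrix.toEuclideanLin (Matrix.of H)).singularValues_nonneg (l.rev : ℕ)
  exact pow_le_pow_left₀ h2 h1 2

/-- The singular values beyond the rank vanish, so the surplus factors are `f 0 = 1`. The freedom in
`f` covers determinants (`f x = 1 + c x`) as well as uniform bounds (`f` an indicator). -/
theorem prod_sq_singularValues {nr nt : ℕ} (H : Channel nr nt) (f : ℝ → ℝ) (hf : f 0 = 1) :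
    ∏ i : Fin nt, f ((Matrix.toEuclideanLin (Matrix.of H)).singularValues i ^ 2) =
      ∏ l, f (phi H l) := by
  set L := Matrix.toEuclideanLin (Matrix.of H) with hL
  set g : ℕ → ℝ := fun i => f (L.singularValues i ^ 2) with hg
  have hr : Module.finrank ℂ (LinearMap.range L) ≤ min nr nt := by
    refine le_min ?_ ?_
    · simpa using Submodule.finrank_le (LinearMap.range L)
    · simpa using LinearMap.finrank_range_le L
  have h1 : ∀ i, min nr nt ≤ i → g i = 1 := by
    intro i hi
    have : L.singularValues i = 0 :=
      L.singularValues_eq_zero_iff_le_finrank_range.2 (hr.trans hi)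
    simp [hg, this, hf]
  have h2 : ∏ i : Fin nt, g i = ∏ i : Fin (min nr nt), g i := by
    rw [Fin.prod_univ_eq_prod_range, Fin.prod_univ_eq_prod_range]
    refine (Finset.prod_subset (Finset.range_mono (min_le_right _ _)) fun i _ hi => ?_).symm
    exact h1 i (not_lt.1 fun h => hi (Finset.mem_range.2 h))
  refine h2.trans ?_
  rw [← Equiv.prod_comp Fin.revPerm]
  rfl

/-- `V` takes coordinates in an orthonormal eigenbasis of `H* H` and `lam` lists its `nt`
eigenvalues. The determinant is moved from `H H*` to `H* H` by Sylvester's identity and then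
diagonalized by `V`. -/
theorem exists_spectral {nr nt : ℕ} (H : Channel nr nt) :
    ∃ (V : Matrix (Fin nt) (Fin nt) ℂ) (lam : Fin nt → ℝ), (∀ i, 0 ≤ lam i) ∧
      (∀ (T : ℕ) (X : Block nt T), energy (V * Matrix.of X : Block nt T) = energy X) ∧
      (∀ (T : ℕ) (X : Block nt T), energy (received H X) =
        ∑ i, lam i * ∑ t, ‖(V * Matrix.of X) i t‖ ^ 2) ∧
      (∀ f : ℝ → ℝ, f 0 = 1 → ∏ i, f (lam i) = ∏ l, f (phi H l)) ∧
      ∀ c : ℝ, (1 + (c : ℂ) • (Matrix.of H * (Matrix.of H)ᴴ)).det =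
        ((∏ i, (1 + c * lam i) : ℝ) : ℂ) := by
  set L := Matrix.toEuclideanLin (Matrix.of H) with hL
  have hn : Module.finrank ℂ (EuclideanSpace ℂ (Fin nt)) = nt := by simp
  have hS := L.isSymmetric_adjoint_comp_self
  set e := hS.eigenvectorBasis hn with he
  set lam : Fin nt → ℝ := fun i => L.singularValues i ^ 2 with hlam
  have hev : ∀ i, (LinearMap.adjoint L ∘ₗ L) (e i) = (lam i : ℂ) • e i := by
    intro i
    rw [he, hS.apply_eigenvectorBasis hn i]
    simp only [hlam]
    rw [L.sq_singularValues_fin hn i]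
    rfl
  obtain ⟨V, hV⟩ : ∃ V : Matrix (Fin nt) (Fin nt) ℂ, ∀ i j, V i j = star (e i j) :=
    ⟨fun i j => star (e i j), fun _ _ => rfl⟩
  have hcoord : ∀ (T : ℕ) (X : Block nt T) i t,
      (V * Matrix.of X) i t = inner ℂ (e i) (WithLp.toLp 2 fun j => X j t) := by
    intro T X i t
    simp [Matrix.mul_apply, hV, PiLp.inner_apply, mul_comm]
  have hnorm : ∀ x, ‖L x‖ ^ 2 = ∑ i, lam i * ‖inner ℂ (e i) x‖ ^ 2 := by
    intro x
    have h1 : ((‖L x‖ ^ 2 : ℝ) : ℂ) = inner ℂ x ((LinearMap.adjoint L ∘ₗ L) x) := by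
      rw [LinearMap.comp_apply, LinearMap.adjoint_inner_right, inner_self_eq_norm_sq_to_K]
      simp
    have h2 : inner ℂ x ((LinearMap.adjoint L ∘ₗ L) x) =
        ∑ i, inner ℂ x (e i) * inner ℂ (e i) ((LinearMap.adjoint L ∘ₗ L) x) :=
      (e.sum_inner_mul_inner _ _).symm
    have h3 : ∀ i, inner ℂ x (e i) * inner ℂ (e i) ((LinearMap.adjoint L ∘ₗ L) x) =
        ((lam i * ‖inner ℂ (e i) x‖ ^ 2 : ℝ) : ℂ) := by
      intro i
      rw [← hS (e i) x, hev i, inner_smul_left, ← inner_conj_symm x (e i)]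
      rw [Complex.conj_ofReal, mul_left_comm, Complex.conj_mul']
      push_cast; rfl
    have h4 : ((‖L x‖ ^ 2 : ℝ) : ℂ) = ((∑ i, lam i * ‖inner ℂ (e i) x‖ ^ 2 : ℝ) : ℂ) := by
      rw [h1, h2, Finset.sum_congr rfl fun i _ => h3 i]
      push_cast; rfl
    exact_mod_cast h4
  refine ⟨V, lam, fun i => sq_nonneg _, fun T X => ?_, fun T X => ?_,
    fun f hf => prod_sq_singularValues H f hf, fun c => ?_⟩
  · unfold energy
    simp only [hcoord]
    rw [Finset.sum_comm]
    simp only [e.sum_sq_norm_inner_right, EuclideanSpace.norm_sq_eq]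
    rw [Finset.sum_comm]
  · simp only [Finset.mul_sum, hcoord]
    rw [Finset.sum_comm]
    simp only [← hnorm]
    unfold energy received
    rw [Finset.sum_comm]
    refine Finset.sum_congr rfl fun t _ => ?_
    rw [EuclideanSpace.norm_sq_eq]
    rfl
  · have hVV : V * Vᴴ = 1 := by
      ext i j
      have := (orthonormal_iff_ite.1 e.orthonormal) i j
      rw [Matrix.one_apply, ← this]
      simp [Matrix.mul_apply, hV, PiLp.inner_apply, mul_comm]
    have hdetV : V.det ≠ 0 := by
      intro h
      have := congrArg Matrix.det hVV
      simp [h] at this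
    have hadj : LinearMap.adjoint L = Matrix.toEuclideanLin (Matrix.of H)ᴴ := by
      rw [hL, Matrix.toEuclideanLin_conjTranspose_eq_adjoint]
    have hmat : V * ((Matrix.of H)ᴴ * Matrix.of H) =
        Matrix.diagonal (fun i => (lam i : ℂ)) * V := by
      rw [← Matrix.conjTranspose_inj]
      ext j i
      have h1 := congrArg (fun x : EuclideanSpace ℂ (Fin nt) => x j) (hev i)
      rw [LinearMap.comp_apply, hadj, hL] at h1
      simp only [Matrix.toLpLin_apply, Matrix.mulVec_mulVec] at h1
      rw [Matrix.conjTranspose_mul, Matrix.conjTranspose_mul, Matrix.conjTranspose_conjTranspose,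
        Matrix.conjTranspose_mul, Matrix.diagonal_conjTranspose, Matrix.mul_diagonal]
      have h2 : (((Matrix.of H)ᴴ * Matrix.of H) * Vᴴ) j i =
          (((Matrix.of H)ᴴ * Matrix.of H) *ᵥ (e i : Fin nt → ℂ)) j := by
        simp [Matrix.mul_apply, Matrix.mulVec, dotProduct, hV]
      rw [h2, h1]
      simp [hV, mul_comm]
    have h1 : (1 + (c : ℂ) • (Matrix.of H * (Matrix.of H)ᴴ)).det =
        (1 + (c : ℂ) • ((Matrix.of H)ᴴ * Matrix.of H)).det := by
      rw [← Matrix.smul_mul, Matrix.det_one_add_mul_comm, Matrix.mul_smul]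
    have h2 : V * (1 + (c : ℂ) • ((Matrix.of H)ᴴ * Matrix.of H)) =
        Matrix.diagonal (fun i => ((1 + c * lam i : ℝ) : ℂ)) * V := by
      rw [mul_add, mul_one, Matrix.mul_smul, hmat]
      ext i j
      simp [Matrix.diagonal_mul]
      ring
    have h3 := congrArg Matrix.det h2
    rw [Matrix.det_mul, Matrix.det_mul, Matrix.det_diagonal, mul_comm] at h3
    rw [h1, mul_right_cancel₀ hdetV h3]
    push_cast; rfl

theorem det_re_eq_prod {nr nt : ℕ} (H : Channel nr nt) (c : ℝ) :
    (1 + (c : ℂ) • (Matrix.of H * (Matrix.of H)ᴴ)).det.re = ∏ l, (1 + c * phi H l) := by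
  obtain ⟨V, lam, -, -, -, h, hd⟩ := exists_spectral H
  rw [hd, Complex.ofReal_re, h (fun x => 1 + c * x) (by simp)]

/-! ### Exponents -/

theorem rpow_le_iff_le_logb_div {snr : ℝ} (h : 1 < snr) {p : ℝ} (hp : 0 < p) (x : ℝ) :
    snr ^ x ≤ p ↔ x ≤ Real.logb 2 p / Real.logb 2 snr := by
  have h0 : 0 < snr := by linarith
  rw [le_div_iff₀ (Real.logb_pos one_lt_two h), ← Real.logb_rpow_eq_mul_logb_of_pos h0,
    Real.logb_le_logb one_lt_two (by positivity) hp]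

theorem le_rpow_iff_logb_div_le {snr : ℝ} (h : 1 < snr) {p : ℝ} (hp : 0 < p) (x : ℝ) :
    p ≤ snr ^ x ↔ Real.logb 2 p / Real.logb 2 snr ≤ x := by
  have h0 : 0 < snr := by linarith
  rw [div_le_iff₀ (Real.logb_pos one_lt_two h), ← Real.logb_rpow_eq_mul_logb_of_pos h0,
    Real.logb_le_logb one_lt_two hp (by positivity)]

theorem HasExponent.eventually_rpow_le {p : ℝ → ℝ} {d δ : ℝ} (h : HasExponent p d) (hδ : 0 < δ) :
    ∀ᶠ snr in atTop, snr ^ (-d - δ) ≤ p snr := by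
  filter_upwards [h.1, h.2.eventually_const_le (show -d - δ < -d by linarith),
    eventually_gt_atTop 1] with snr h1 h2 h3
  exact (rpow_le_iff_le_logb_div h3 h1 _).2 h2

theorem HasExponent.eventually_le_rpow {p : ℝ → ℝ} {d δ : ℝ} (h : HasExponent p d) (hδ : 0 < δ) :
    ∀ᶠ snr in atTop, p snr ≤ snr ^ (-d + δ) := by
  filter_upwards [h.1, h.2.eventually_le_const (show -d < -d + δ by linarith),
    eventually_gt_atTop 1] with snr h1 h2 h3
  exact (le_rpow_iff_logb_div_le h3 h1 _).2 h2

theorem hasExponent_of_bounds {p : ℝ → ℝ} {d : ℝ}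
    (h1 : ∀ δ > 0, ∀ᶠ snr in atTop, snr ^ (-d - δ) ≤ p snr)
    (h2 : ∀ δ > 0, ∀ᶠ snr in atTop, p snr ≤ snr ^ (-d + δ)) : HasExponent p d := by
  have hpos : ∀ᶠ snr in atTop, 0 < p snr := by
    filter_upwards [h1 1 one_pos, eventually_gt_atTop 0] with snr h h0
    exact (Real.rpow_pos_of_pos h0 _).trans_le h
  refine ⟨hpos, tendsto_order.2 ⟨fun a ha => ?_, fun a ha => ?_⟩⟩
  · filter_upwards [h1 ((-d - a) / 2) (by linarith), hpos, eventually_gt_atTop 1] with snr h h0 h3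
    have := (rpow_le_iff_le_logb_div h3 h0 _).1 h
    linarith
  · filter_upwards [h2 ((a + d) / 2) (by linarith), hpos, eventually_gt_atTop 1] with snr h h0 h3
    have := (le_rpow_iff_logb_div_le h3 h0 _).1 h
    linarith

theorem HasExponent.le_of_eventually_rpow_le {p : ℝ → ℝ} {d d' : ℝ} (h : HasExponent p d)
    (h' : ∀ δ > 0, ∀ᶠ snr in atTop, snr ^ (-d' - δ) ≤ p snr) : d ≤ d' := by
  refine le_of_forall_pos_le_add fun δ hδ => ?_
  have : -d' - δ ≤ -d := by
    refine ge_of_tendsto h.2 ?_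
    filter_upwards [h' δ hδ, h.1, eventually_gt_atTop 1] with snr h1 h2 h3
    exact (rpow_le_iff_le_logb_div h3 h2 _).1 h1
  linarith

theorem eventually_const_mul_rpow_le (C : ℝ) {a b : ℝ} (hab : a < b) :
    ∀ᶠ snr : ℝ in atTop, C * snr ^ a ≤ snr ^ b := by
  filter_upwards [(tendsto_rpow_atTop (sub_pos.2 hab)).eventually_ge_atTop C,
    eventually_gt_atTop 0] with snr h1 h2
  calc C * snr ^ a ≤ snr ^ (b - a) * snr ^ a := by gcongr
    _ = snr ^ b := by rw [← Real.rpow_add h2]; congr 1; ring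

theorem eventually_exp_neg_mul_rpow_le (C : ℝ) {c η : ℝ} (hc : 0 < c) (hη : 0 < η) (b : ℝ) :
    ∀ᶠ snr : ℝ in atTop, C * Real.exp (-(c * snr ^ η)) ≤ snr ^ b := by
  have h1 : Tendsto (fun x : ℝ => x ^ (-b / η) * Real.exp (-c * x)) atTop (𝓝 0) :=
    tendsto_rpow_mul_exp_neg_mul_atTop_nhds_zero _ _ hc
  have h2 := h1.comp (tendsto_rpow_atTop hη)
  have h3 : Tendsto (fun snr : ℝ => C * ((snr ^ η) ^ (-b / η) * Real.exp (-c * snr ^ η))) atTop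
      (𝓝 0) := by simpa using h2.const_mul C
  filter_upwards [h3.eventually_le_const one_pos, eventually_gt_atTop 0] with snr h h0
  rw [← Real.rpow_mul h0.le, mul_div_cancel₀ _ hη.ne', Real.rpow_neg h0.le, ← neg_mul] at *
  have hb : 0 < snr ^ b := Real.rpow_pos_of_pos h0 b
  have h5 : C * ((snr ^ b)⁻¹ * Real.exp (-c * snr ^ η)) =
      C * Real.exp (-c * snr ^ η) / snr ^ b := by field_simp
  rw [h5, div_le_one hb] at h
  exact h

/-! ### The linear programme behind the tradeoff curve -/

/-- Weak duality, with multiplier `K = k s.rev + 1` for the rate constraint. Since `max(a, 0) +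
max(1 - a, 0) ≥ 1`, coordinate `l` contributes at least `min (k l + 1) K`. The minimum is `K` for
the `s + 1` indices `l ≥ s.rev`, so these minima add up to `segment k s r + K r`. -/
theorem segment_le {n : ℕ} {k : Fin n → ℝ} (hk : StrictMono k) (hk0 : ∀ l, 0 ≤ k l + 1)
    (s : Fin n) (r : ℝ) (a : Fin n → ℝ) :
    segment k s r ≤
      ∑ l, (k l + 1) * max (a l) 0 + (k s.rev + 1) * (∑ l, max (1 - a l) 0 - r) := by
  have h1 : ∀ l, (if l < s.rev then k l + 1 else k s.rev + 1) ≤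
      (k l + 1) * max (a l) 0 + (k s.rev + 1) * max (1 - a l) 0 := by
    intro l
    have h2 : 1 ≤ max (a l) 0 + max (1 - a l) 0 := by
      have := le_max_left (a l) 0
      have := le_max_left (1 - a l) 0
      linarith
    have h3 : 0 ≤ max (a l) 0 := le_max_right _ _
    have h4 : 0 ≤ max (1 - a l) 0 := le_max_right _ _
    split_ifs with h
    · have h5 := hk h
      have h6 := hk0 l
      nlinarith
    · have h5 := hk.monotone (not_lt.1 h)
      have h6 := hk0 s.rev
      nlinarith
  have h2 := Finset.sum_le_sum fun l (_ : l ∈ Finset.univ) => h1 l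
  rw [Finset.sum_add_distrib, ← Finset.mul_sum, Finset.sum_ite, Finset.sum_const] at h2
  have h3 : (Finset.univ.filter fun l => ¬ l < s.rev) = Finset.Ici s.rev := by
    ext l; simp
  have h4 : (Finset.univ.filter fun l => l < s.rev) = Finset.Iio s.rev := by
    ext l; simp
  have h5 : (Finset.Ici s.rev).card = s + 1 := by
    rw [Fin.card_Ici, Fin.val_rev]; omega
  rw [h3, h4, h5, nsmul_eq_mul] at h2
  unfold segment
  push_cast at h2
  linarith

/-- A strictly decreasing scale, as close as one likes to an optimal one, along which the channel
does not support the multiplexing gain `r`. -/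
theorem exists_scale {n : ℕ} (k : Fin n → ℝ) (s : Fin n) {r : ℝ} (hsr : (s : ℝ) ≤ r)
    (hrs : r < (s : ℝ) + 1) {δ : ℝ} (hδ : 0 < δ) :
    ∃ α : Fin n → ℝ, StrictAnti α ∧
      ∑ l, (k l + 1) * max (α l) 0 < segment k s r + δ ∧
      ((0 < r ∧ ∑ l, max (1 - α l) 0 < r) ∨ (r = 0 ∧ ∀ l, 1 < α l)) := by
  -- `b l` is the share of the multiplexing gain carried by direction `l` at the optimum `α = 1 -
  -- b`; the shares add up to `r`.
  set b : Fin n → ℝ := fun l => if l < s.rev then 0 else if l = s.rev then r - s else 1 with hb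
  have hb0 : ∀ l, 0 ≤ b l := by
    intro l; simp only [hb]; split_ifs <;> linarith
  have hb1 : ∀ l, b l ≤ 1 := by
    intro l; simp only [hb]; split_ifs <;> linarith
  have hbmono : Monotone b := by
    intro l l' h
    by_cases h1 : l < s.rev
    · have : b l = 0 := by simp [hb, h1]
      rw [this]; exact hb0 l'
    · by_cases h2 : l = s.rev
      · rcases h.eq_or_lt with h3 | h3
        · rw [h3]
        · have : b l' = 1 := by
            have h4 : ¬ l' < s.rev := not_lt.2 (h2 ▸ h)
            have h5 : l' ≠ s.rev := (h2 ▸ h3).ne'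
            simp [hb, h4, h5]
          rw [this]; exact hb1 l
      · have h3 : s.rev < l := lt_of_le_of_ne (not_lt.1 h1) (Ne.symm h2)
        have h4 : ¬ l' < s.rev := not_lt.2 (h3.le.trans h)
        have h5 : l' ≠ s.rev := (h3.trans_le h).ne'
        have : b l' = 1 := by simp [hb, h4, h5]
        rw [this]; exact hb1 l
  have hsplit : ∀ g : Fin n → ℝ, ∑ l, g l =
      ∑ l ∈ Finset.Iio s.rev, g l + g s.rev + ∑ l ∈ Finset.Ioi s.rev, g l := by
    intro g
    have h3 : (Finset.univ.filter fun l => ¬ l < s.rev) = Finset.Ici s.rev := by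
      ext l; simp
    have h4 : (Finset.univ.filter fun l => l < s.rev) = Finset.Iio s.rev := by
      ext l; simp
    rw [← Finset.sum_filter_add_sum_filter_not Finset.univ (fun l => l < s.rev), h3, h4,
      ← Finset.Ioi_insert, Finset.sum_insert (by simp)]
    ring
  have hbIio : ∀ l ∈ Finset.Iio s.rev, b l = 0 := by
    intro l hl
    simp [hb, Finset.mem_Iio.1 hl]
  have hbrev : b s.rev = r - s := by simp [hb]
  have hbIoi : ∀ l ∈ Finset.Ioi s.rev, b l = 1 := by
    intro l hl
    have h1 := Finset.mem_Ioi.1 hl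
    simp [hb, h1.ne', not_lt.2 h1.le]
  have hcard : (Finset.Ioi s.rev).card = s := by
    rw [Fin.card_Ioi, Fin.val_rev]; omega
  have hbsum : ∑ l, b l = r := by
    rw [hsplit, Finset.sum_eq_zero hbIio, hbrev, Finset.sum_congr rfl hbIoi, Finset.sum_const,
      hcard]
    simp
  have hseg : ∑ l, (k l + 1) * (1 - b l) = segment k s r := by
    rw [hsplit, hbrev, Finset.sum_congr rfl fun l hl => by rw [hbIio l hl],
      Finset.sum_eq_zero (s := Finset.Ioi s.rev) fun l hl => by rw [hbIoi l hl]; ring]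
    unfold segment
    simp only [sub_zero, mul_one]
    ring
  set S : ℝ := ∑ l : Fin n, (k l + 1) * ((n : ℝ) - l) with hS
  set θ : ℝ := δ / (|S| + 1) with hθ
  have hθ0 : 0 < θ := by positivity
  have hl : ∀ l : Fin n, (1 : ℝ) ≤ (n : ℝ) - l := by
    intro l
    have : (l : ℝ) + 1 ≤ n := by exact_mod_cast l.2
    linarith
  have hθl : ∀ l : Fin n, 0 < θ * ((n : ℝ) - l) := fun l => by
    have := hl l; positivity
  -- The perturbation is positive and strictly decreasing in `l`: it makes the scale strict and the
  -- rate constraint strict, and costs `θ S < δ`.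
  refine ⟨fun l => 1 - b l + θ * ((n : ℝ) - l), ?_, ?_, ?_⟩
  · intro l l' h
    have h1 := hbmono h.le
    have h2 : (l : ℝ) < l' := by exact_mod_cast h
    have h3 : θ * ((n : ℝ) - l') < θ * ((n : ℝ) - l) := by gcongr
    simp only
    linarith
  · have h1 : ∀ l, (k l + 1) * max (1 - b l + θ * ((n : ℝ) - l)) 0 =
        (k l + 1) * (1 - b l) + θ * ((k l + 1) * ((n : ℝ) - l)) := by
      intro l
      have := hθl l
      have := hb1 l
      rw [max_eq_left (by linarith)]; ring
    rw [Finset.sum_congr rfl fun l _ => h1 l, Finset.sum_add_distrib, ← Finset.mul_sum, hseg]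
    have h2 : θ * S < δ := by
      have h3 : θ * (|S| + 1) = δ := by rw [hθ]; field_simp
      have h4 : θ * S ≤ θ * |S| := by gcongr; exact le_abs_self S
      linarith
    linarith
  · rcases (show 0 ≤ r from (Nat.cast_nonneg _).trans hsr).eq_or_lt with h | h
    · refine Or.inr ⟨h.symm, fun l => ?_⟩
      have : b l ≤ ∑ l, b l := Finset.single_le_sum (fun l _ => hb0 l) (Finset.mem_univ l)
      have := hθl l
      linarith
    · refine Or.inl ⟨h, ?_⟩
      obtain ⟨l₀, -, hl₀⟩ : ∃ l ∈ Finset.univ, (0 : ℝ) < b l := by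
        refine Finset.exists_lt_of_sum_lt (f := fun _ => (0 : ℝ)) ?_
        rw [hbsum]; simpa using h
      rw [← hbsum]
      refine Finset.sum_lt_sum (fun l _ => max_le ?_ (hb0 l))
        ⟨l₀, Finset.mem_univ _, max_lt ?_ hl₀⟩
      · have := hθl l; linarith
      · have := hθl l₀; linarith

/-- On the scale `1, 0, -1, …` only the smallest singular value is constrained, so the exponent is
`k_1 + 1`. It is nonnegative because a probability is at most one, and `k` is increasing. -/
theorem NearZeroBehavior.nonneg {nr nt : ℕ} {μ : Measure (Channel nr nt)} [IsProbabilityMeasure μ]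
    {k : Fin (min nr nt) → ℝ} (hk : StrictMono k) (hzero : NearZeroBehavior μ k)
    (l : Fin (min nr nt)) : 0 ≤ k l + 1 := by
  have hn : 0 < min nr nt := l.pos
  set z : Fin (min nr nt) := ⟨0, hn⟩ with hz
  have hzl : k z ≤ k l := hk.monotone (Nat.zero_le _)
  have h := hzero (fun i => 1 - (i : ℝ)) (fun i j hij => by
    have : (i : ℝ) < j := by exact_mod_cast hij
    simp only; linarith)
  have hsum : ∑ i : Fin (min nr nt), (k i + 1) * max (1 - (i : ℝ)) 0 = k z + 1 := by
    rw [Finset.sum_eq_single z]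
    · simp [hz]
    · intro i _ hi
      have : 1 ≤ (i : ℕ) := by
        by_contra hcon
        exact hi (Fin.ext (by simp only [hz]; omega))
      have : (1 : ℝ) ≤ i := by exact_mod_cast this
      rw [max_eq_right (by linarith), mul_zero]
    · simp
  rw [hsum] at h
  have h1 : -(k z + 1) ≤ 0 := by
    refine le_of_tendsto h.2 ?_
    filter_upwards [h.1, eventually_gt_atTop 1] with snr h1 h2
    refine (le_rpow_iff_logb_div_le h2 h1 0).1 ?_
    rw [Real.rpow_zero]
    exact measureReal_le_one
  linarith

/-! ### Upper bound for channel averages -/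

/-- Quantization of the polynomial decay of the squared singular values. -/
theorem exists_grid_scale {nr nt : ℕ} {H : Channel nr nt} {snr : ℝ} (hsnr : 1 < snr)
    (hH : ∀ l, phi H l ≤ snr) {N : ℕ} (hN : 0 < N) :
    ∃ j : Fin (min nr nt) → Fin (N + 1), Antitone j ∧
      (∀ l, phi H l ≤ snr ^ (1 - 2 * (j l : ℝ) / N)) ∧
      ∀ l, snr ^ (max (2 - 2 * (j l : ℝ) / N - 2 / N) 0) / 16 ≤ 1 + snr / 16 * phi H l := by
  have hs0 : 0 < snr := by linarith
  -- The grid runs through the exponents from `1` down to `-1` in steps `2 / N`; `j l` is the last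
  -- grid point still above `φ_l`. Nothing finer is needed below `snr ^ (-1)`, where `snr φ_l` is
  -- bounded.
  set P : Fin (min nr nt) → ℕ → Prop := fun l i => phi H l ≤ snr ^ (1 - 2 * (i : ℝ) / N) with hP
  classical
  have hP0 : ∀ l, P l 0 := fun l => by simpa [hP] using hH l
  refine ⟨fun l => ⟨Nat.findGreatest (P l) N, Nat.lt_succ_of_le (Nat.findGreatest_le N)⟩,
    fun l l' h => ?_, fun l => ?_, fun l => ?_⟩
  · exact Nat.findGreatest_mono_left (fun i hi => (phi_monotone H h).trans hi) N
  · exact Nat.findGreatest_spec (P := P l) (Nat.zero_le N) (hP0 l)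
  · have hφ := phi_nonneg H l
    simp only
    set i := Nat.findGreatest (P l) N with hi
    have hiN : i ≤ N := Nat.findGreatest_le N
    have hN' : (0 : ℝ) < N := by exact_mod_cast hN
    rcases hiN.eq_or_lt with h | h
    · have h1 : (2 : ℝ) - 2 * (i : ℝ) / N - 2 / N ≤ 0 := by
        rw [h, mul_div_assoc, div_self hN'.ne']
        have : (0 : ℝ) < 2 / N := by positivity
        linarith
      rw [max_eq_right h1, Real.rpow_zero]
      have : 0 ≤ snr / 16 * phi H l := by positivity
      linarith
    · have h1 : ¬ P l (i + 1) := Nat.findGreatest_is_greatest (Nat.lt_succ_self i) h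
      have h2 : snr ^ (1 - 2 * ((i + 1 : ℕ) : ℝ) / N) < phi H l := not_le.1 h1
      have h3 : (0 : ℝ) ≤ 2 - 2 * (i : ℝ) / N - 2 / N := by
        have h4 : ((i : ℝ) + 1) ≤ N := by exact_mod_cast h
        have h5 : 2 * (i : ℝ) / N + 2 / N = 2 * ((i + 1) / N) := by ring
        have h6 : ((i : ℝ) + 1) / N ≤ 1 := (div_le_one hN').2 h4
        linarith
      rw [max_eq_left h3]
      have h4 : snr ^ (2 - 2 * (i : ℝ) / N - 2 / N) = snr * snr ^ (1 - 2 * ((i +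
          1 : ℕ) : ℝ) / N) := by
        nth_rewrite 2 [← Real.rpow_one snr]
        rw [← Real.rpow_add hs0]
        congr 1
        push_cast
        ring
      rw [h4]
      have h5 : snr * snr ^ (1 - 2 * ((i + 1 : ℕ) : ℝ) / N) ≤ snr * phi H l := by gcongr
      linarith

/-- The sets `B i` need not be measurable: each is replaced by its measurable hull, cut down to
where `f ≤ c i`. This spares any measurability argument for `phi`. -/
theorem lintegral_le_sum_of_cover {Ω ι : Type*} [MeasurableSpace Ω] [Fintype ι] (μ : Measure Ω)
    {f : Ω → ENNReal} (hf : Measurable f) (B : ι → Set Ω) (c : ι → ENNReal)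
    (h : ∀ x, ∃ i, x ∈ B i ∧ f x ≤ c i) : ∫⁻ x, f x ∂μ ≤ ∑ i, c i * μ (B i) := by
  set A : ι → Set Ω := fun i => toMeasurable μ (B i) ∩ {x | f x ≤ c i} with hA
  have hAm : ∀ i, MeasurableSet (A i) := fun i =>
    (measurableSet_toMeasurable _ _).inter (measurableSet_le hf measurable_const)
  calc ∫⁻ x, f x ∂μ ≤ ∫⁻ x, ∑ i, (A i).indicator (fun _ => c i) x ∂μ := by
        refine lintegral_mono fun x => ?_
        obtain ⟨i, hi, hc⟩ := h x
        have h1 : x ∈ A i := ⟨subset_toMeasurable _ _ hi, hc⟩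
        calc f x ≤ (A i).indicator (fun _ => c i) x := by rwa [Set.indicator_of_mem h1]
          _ ≤ _ := Finset.single_le_sum (f := fun i => (A i).indicator (fun _ => c i) x)
            (fun _ _ => zero_le) (Finset.mem_univ i)
    _ = ∑ i, c i * μ (A i) := by
        rw [lintegral_finsetSum _ fun i _ => measurable_const.indicator (hAm i)]
        exact Finset.sum_congr rfl fun i _ => lintegral_indicator_const (hAm i) _
    _ ≤ _ := by
        refine Finset.sum_le_sum fun i _ => ?_
        exact mul_le_mul_right ((measure_mono Set.inter_subset_left).trans
          (measure_toMeasurable (B i)).le) (c i)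

/-- Stable form of `segment_le`: `a` and `b` bound the rounding errors of the grid, and the loss is
linear in them. -/
theorem segment_le_of_approx {n : ℕ} {k : Fin n → ℝ} (hk : StrictMono k)
    (hk0 : ∀ l, 0 ≤ k l + 1) (s : Fin n) (r : ℝ) (α α' β : Fin n → ℝ) {a b : ℝ} (ha : 0 ≤ a)
    (hb : 0 ≤ b) (hα : ∀ l, α l ≤ α' l + a) (hβ : ∀ l, 1 - α l ≤ β l + b) (hβ0 : ∀ l, 0 ≤ β l) :
    segment k s r ≤ ∑ l, (k l + 1) * max (α' l) 0 + (k s.rev + 1) * (∑ l, β l - r) +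
      ((∑ l, (k l + 1)) * a + (k s.rev + 1) * (n * b)) := by
  have h1 := segment_le hk hk0 s r α
  have h2 : ∑ l, (k l + 1) * max (α l) 0 ≤
      ∑ l, (k l + 1) * max (α' l) 0 + (∑ l, (k l + 1)) * a := by
    rw [Finset.sum_mul, ← Finset.sum_add_distrib]
    refine Finset.sum_le_sum fun l _ => ?_
    rw [← mul_add]
    refine mul_le_mul_of_nonneg_left (max_le ?_ ?_) (hk0 l)
    · have := le_max_left (α' l) 0
      have := hα l
      linarith
    · have := le_max_right (α' l) 0
      linarith
  have h3 : ∑ l, max (1 - α l) 0 ≤ ∑ l, β l + n * b := by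
    have : (n : ℝ) * b = ∑ l : Fin n, b := by simp
    rw [this, ← Finset.sum_add_distrib]
    exact Finset.sum_le_sum fun l _ => max_le (hβ l) (by have := hβ0 l; linarith)
  have h4 : (k s.rev + 1) * (∑ l, max (1 - α l) 0 - r) ≤
      (k s.rev + 1) * (∑ l, β l + n * b - r) := by
    have := hk0 s.rev
    gcongr
  have h5 : (k s.rev + 1) * (∑ l, β l + n * b - r) =
      (k s.rev + 1) * (∑ l, β l - r) + (k s.rev + 1) * (n * b) := by ring
  linarith

set_option maxHeartbeats 800000 in
-- The channels are covered by finitely many boxes, one per antitone grid vector, and by the events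
-- `φ_l ≥ snr`, which are exponentially rare. In a box, `f` times the probability has the exponent
-- that duality bounds. The constants, such as the powers of 16, are absorbed by part of `δ`.
theorem eventually_lintegral_le {nr nt : ℕ} {μ : Measure (Channel nr nt)} [IsProbabilityMeasure μ]
    {k : Fin (min nr nt) → ℝ} (hk : StrictMono k) (hzero : NearZeroBehavior μ k)
    (htail : ExponentialTails μ) (s : Fin (min nr nt)) (r : ℝ) {τ : ℕ}
    (hτ : k s.rev + 1 ≤ τ) {δ : ℝ} (hδ : 0 < δ) :
    ∃ δ₀ > 0, ∀ᶠ snr : ℝ in atTop, ∀ f : Channel nr nt → ENNReal, Measurable f →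
      (∀ H, f H ≤ 1) →
      (∀ H, f H ≤ ENNReal.ofReal
        (snr ^ (τ * (r + δ₀)) * ((∏ l, (1 + snr / 16 * phi H l)) ^ τ)⁻¹)) →
      ∫⁻ H, f H ∂μ ≤ ENNReal.ofReal (snr ^ (-segment k s r + δ)) := by
  have hk0 := hzero.nonneg hk
  set K := k s.rev + 1 with hK
  have hK0 : 0 ≤ K := hk0 _
  set S := ∑ l, (k l + 1) with hS
  have hS0 : 0 ≤ S := Finset.sum_nonneg fun l _ => hk0 l
  -- Budget: grid rounding, the rate slack `K δ₀` and the box probabilities each cost at most `δ /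
  -- 8`. Their total is below `δ / 2`, and the other half absorbs the constants.
  obtain ⟨N, hN⟩ := exists_nat_gt (((min nr nt : ℕ) * S + 2 * (min nr nt : ℕ) * K) / (δ / 8))
  have hN0 : (0 : ℝ) < N := lt_of_le_of_lt (by positivity) hN
  have hNpos : 0 < N := by exact_mod_cast hN0
  have hNle : ((min nr nt : ℕ) * S + 2 * (min nr nt : ℕ) * K) / N ≤ δ / 8 := by
    rw [div_le_iff₀ hN0]
    rw [div_lt_iff₀ (by positivity)] at hN
    linarith
  set δ₀ := δ / (8 * (K + 1)) with hδ₀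
  have hδ₀pos : 0 < δ₀ := by positivity
  have hKδ₀ : K * δ₀ ≤ δ / 8 := by
    have : (K + 1) * δ₀ = δ / 8 := by rw [hδ₀]; field_simp
    nlinarith
  refine ⟨δ₀, hδ₀pos, ?_⟩
  let J := {j : Fin (min nr nt) → Fin (N + 1) // Antitone j}
  have : Fintype J := Fintype.ofFinite J
  let α : J → Fin (min nr nt) → ℝ := fun j l => -1 + 2 * (j.1 l : ℝ) / N
  -- The tilt `l / N` turns the antitone vector into a strictly decreasing one, as
  -- `NearZeroBehavior` requires, and only enlarges the box.
  let α' : J → Fin (min nr nt) → ℝ := fun j l => α j l - (l : ℝ) / N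
  have hα' : ∀ j, StrictAnti (α' j) := by
    intro j l l' h
    have h1 : ((j.1 l' : ℕ) : ℝ) ≤ (j.1 l : ℕ) := by exact_mod_cast j.2 h.le
    have h2 : ((l : ℕ) : ℝ) < l' := by exact_mod_cast h
    have h3 : 2 * ((j.1 l' : ℕ) : ℝ) / N ≤ 2 * ((j.1 l : ℕ) : ℝ) / N := by gcongr
    have h4 : ((l : ℕ) : ℝ) / N < (l' : ℕ) / N := by gcongr
    simp only [α', α]
    linarith
  let e : J → ℝ := fun j => ∑ l, max (2 - 2 * (j.1 l : ℝ) / N - 2 / N) 0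
  have hexp : ∀ j, -(K * (e j - r - δ₀)) + (-(∑ l, (k l + 1) * max (α' j l) 0) + δ / 8) ≤
      -segment k s r + δ / 2 := by
    intro j
    have h1 := segment_le_of_approx hk hk0 s r (α j) (α' j)
      (fun l => max (2 - 2 * (j.1 l : ℝ) / N - 2 / N) 0) (a := (min nr nt : ℕ) / N) (b := 2 / N)
      (by positivity) (by positivity) (fun l => ?_) (fun l => ?_) (fun l => le_max_right _ _)
    · have h6 : S * ((min nr nt : ℕ) / N) + K * ((min nr nt : ℕ) * (2 / N)) =
          ((min nr nt : ℕ) * S + 2 * (min nr nt : ℕ) * K) / N := by ring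
      change segment k s r ≤ ∑ l, (k l + 1) * max (α' j l) 0 + K * (e j - r) +
        (S * ((min nr nt : ℕ) / N) + K * ((min nr nt : ℕ) * (2 / N))) at h1
      rw [h6] at h1
      have h7 : K * (e j - r - δ₀) = K * (e j - r) - K * δ₀ := by ring
      rw [h7]
      linarith
    · have h3 : ((l : ℕ) : ℝ) / N ≤ (min nr nt : ℕ) / N := by
        gcongr; exact l.2.le
      simp only [α']
      linarith
    · have := le_max_left (2 - 2 * (j.1 l : ℝ) / N - 2 / N) 0
      simp only [α]
      linarith
  have hbox : ∀ᶠ snr : ℝ in atTop, ∀ j : J,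
      μ.real {H | ∀ l, phi H l ≤ snr ^ (-α' j l)} ≤
        snr ^ (-(∑ l, (k l + 1) * max (α' j l) 0) + δ / 8) :=
    eventually_all.2 fun j => (hzero (α' j) (hα' j)).eventually_le_rpow (by positivity)
  obtain ⟨ε, hε, htail⟩ := htail
  set C : ℝ := Fintype.card J * 16 ^ ((min nr nt : ℕ) * τ) with hC
  have hC0 : 0 ≤ C := by positivity
  filter_upwards [hbox, htail, eventually_gt_atTop 1,
    eventually_const_mul_rpow_le (2 * C) (show -segment k s r + δ / 2 < -segment k s r +
        δ by linarith),
    eventually_exp_neg_mul_rpow_le (2 * (min nr nt : ℕ)) hε one_pos (-segment k s r + δ)]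
    with snr hbox htail hsnr h1 h2 f hf hf1 hf2
  have hs0 : 0 < snr := by linarith
  let B : J ⊕ Fin (min nr nt) → Set (Channel nr nt) := fun o => match o with
    | Sum.inl j => {H | ∀ l, phi H l ≤ snr ^ (-α' j l)}
    | Sum.inr l => {H | snr ≤ phi H l}
  let c : J ⊕ Fin (min nr nt) → ENNReal := fun o => match o with
    | Sum.inl j => ENNReal.ofReal (16 ^ ((min nr nt : ℕ) * τ) * snr ^ (-(K * (e j - r - δ₀))))
    | Sum.inr l => 1
  have hcover : ∀ H, ∃ i, H ∈ B i ∧ f H ≤ c i := by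
    intro H
    by_cases hH : ∀ l, phi H l ≤ snr
    · obtain ⟨j, hj, hj1, hj2⟩ := exists_grid_scale hsnr hH hNpos
      refine ⟨Sum.inl ⟨j, hj⟩, fun l => (hj1 l).trans ?_, ?_⟩
      · refine Real.rpow_le_rpow_of_exponent_le hsnr.le ?_
        have : (0 : ℝ) ≤ ((l : ℕ) : ℝ) / N := by positivity
        simp only [α', α]
        linarith
      · have h16 : (1 : ℝ) ≤ 16 ^ ((min nr nt : ℕ) * τ) := one_le_pow₀ (by norm_num)
        -- Only the power `K` of the decay is wanted. In outage `f ≤ 1` suffices; otherwise the base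
        -- exponent is nonnegative and `τ ≥ K` makes the power `τ` at least as good.
        rcases le_total (e ⟨j, hj⟩ - r - δ₀) 0 with hx | hx
        · refine (hf1 H).trans ?_
          simp only [c]
          rw [← ENNReal.ofReal_one]
          refine ENNReal.ofReal_le_ofReal ?_
          have h3 : 1 ≤ snr ^ (-(K * (e ⟨j, hj⟩ - r - δ₀))) :=
            Real.one_le_rpow hsnr.le (by nlinarith)
          nlinarith
        · refine (hf2 H).trans (ENNReal.ofReal_le_ofReal ?_)
          have h3 : snr ^ e ⟨j, hj⟩ / 16 ^ (min nr nt : ℕ) ≤ ∏ l, (1 + snr / 16 * phi H l) := by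
            have h4 := Finset.prod_le_prod (s := Finset.univ) (fun l _ => by positivity)
              fun l _ => hj2 l
            rw [Finset.prod_div_distrib, Finset.prod_const, Finset.card_univ, Fintype.card_fin,
              ← Real.rpow_sum_of_pos hs0] at h4
            exact h4
          have h4 : ((∏ l, (1 + snr / 16 * phi H l)) ^ τ)⁻¹ ≤
              ((snr ^ e ⟨j, hj⟩ / 16 ^ (min nr nt : ℕ)) ^ τ)⁻¹ := by
            gcongr
          calc _ ≤ snr ^ (τ * (r + δ₀)) * ((snr ^ e ⟨j, hj⟩ / 16 ^ (min nr nt : ℕ)) ^ τ)⁻¹ :=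
              by gcongr
            _ = 16 ^ ((min nr nt : ℕ) * τ) * snr ^ (-(τ * (e ⟨j, hj⟩ - r - δ₀))) := by
                rw [div_pow, inv_div, ← pow_mul, ← Real.rpow_natCast (snr ^ _),
                    ← Real.rpow_mul hs0.le,
                  mul_div_assoc', mul_comm, mul_div_assoc, ← Real.rpow_sub hs0]
                congr 2
                ring
            _ ≤ _ := by
                gcongr
                exact hsnr.le
    · push Not at hH
      obtain ⟨l, hl⟩ := hH
      exact ⟨Sum.inr l, hl.le, hf1 H⟩
  have hsum := lintegral_le_sum_of_cover μ hf B c hcover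
  rw [Fintype.sum_sum_type] at hsum
  simp only [B, c, one_mul] at hsum
  refine hsum.trans ?_
  have hA : ∑ j : J, ENNReal.ofReal (16 ^ ((min nr nt : ℕ) * τ) * snr ^ (-(K * (e j - r - δ₀)))) *
      μ {H | ∀ l, phi H l ≤ snr ^ (-α' j l)} ≤
      ENNReal.ofReal (C * snr ^ (-segment k s r + δ / 2)) := by
    have : ∀ j ∈ (Finset.univ : Finset J),
        ENNReal.ofReal (16 ^ ((min nr nt : ℕ) * τ) * snr ^ (-(K * (e j - r - δ₀)))) *
          μ {H | ∀ l, phi H l ≤ snr ^ (-α' j l)} ≤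
        ENNReal.ofReal (16 ^ ((min nr nt : ℕ) * τ) * snr ^ (-segment k s r + δ / 2)) := by
      intro j _
      rw [← ofReal_measureReal, ← ENNReal.ofReal_mul (by positivity)]
      refine ENNReal.ofReal_le_ofReal ?_
      calc _ ≤ 16 ^ ((min nr nt : ℕ) * τ) * snr ^ (-(K * (e j - r - δ₀))) *
            snr ^ (-(∑ l, (k l + 1) * max (α' j l) 0) + δ / 8) := by
            gcongr; exact hbox j
        _ ≤ _ := by
            rw [mul_assoc, ← Real.rpow_add hs0]
            exact mul_le_mul_of_nonneg_left
              (Real.rpow_le_rpow_of_exponent_le hsnr.le (hexp j)) (by positivity)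
    refine (Finset.sum_le_card_nsmul _ _ _ this).trans ?_
    rw [nsmul_eq_mul, Finset.card_univ, hC, mul_assoc, 
      ENNReal.ofReal_mul (by positivity : (0 : ℝ) ≤ Fintype.card J), ENNReal.ofReal_natCast]
  have hB : ∑ l : Fin (min nr nt), μ {H | snr ≤ phi H l} ≤
      ENNReal.ofReal ((min nr nt : ℕ) * Real.exp (-ε * snr)) := by
    have : ∀ l ∈ (Finset.univ : Finset (Fin (min nr nt))), μ {H | snr ≤ phi H l} ≤
        ENNReal.ofReal (Real.exp (-ε * snr)) := by
      intro l _
      rw [← ofReal_measureReal]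
      exact ENNReal.ofReal_le_ofReal (htail l)
    refine (Finset.sum_le_card_nsmul _ _ _ this).trans ?_
    rw [nsmul_eq_mul, Finset.card_univ, Fintype.card_fin, ENNReal.ofReal_mul (by positivity),
      ENNReal.ofReal_natCast]
  refine (add_le_add hA hB).trans ?_
  rw [← ENNReal.ofReal_add (by positivity) (by positivity)]
  refine ENNReal.ofReal_le_ofReal ?_
  rw [Real.rpow_one, ← neg_mul] at h2
  linarith

/-! ### Error probability for a given channel -/

theorem received_sub {nr nt T : ℕ} (H : Channel nr nt) (X Y : Block nt T) :
    received H X - received H Y = received H (X - Y) :=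
  (Matrix.mul_sub (Matrix.of H) (Matrix.of X) (Matrix.of Y)).symm

theorem continuous_received {nr nt T : ℕ} {Ω : Type*} [TopologicalSpace Ω]
    {H : Ω → Channel nr nt} {X : Ω → Block nt T} (hH : Continuous H) (hX : Continuous X) :
    Continuous fun p => received (H p) (X p) := by
  unfold received
  refine continuous_pi fun i => continuous_pi fun t => ?_
  change Continuous fun p => (Matrix.of (H p) * Matrix.of (X p)) i t
  simp only [Matrix.mul_apply, Matrix.of_apply]
  fun_prop

theorem continuous_energy_error {nr nt T M : ℕ} (i j : Fin M) :
    Continuous fun p : (Fin M → Block nt T) × Channel nr nt × Block nr T =>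
      energy (received p.2.1 (p.1 i) + p.2.2 - received p.2.1 (p.1 j)) := by
  refine continuous_energy.comp (((continuous_received ?_ ?_).add ?_).sub
    (continuous_received ?_ ?_)) <;> fun_prop

theorem measurableSet_error {nr nt T M : ℕ} (i : Fin M) :
    MeasurableSet {p : (Fin M → Block nt T) × Channel nr nt × Block nr T |
      ¬ MLDecides p.2.1 p.1 (received p.2.1 (p.1 i) + p.2.2) i} := by
  have h : MeasurableSet {p : (Fin M → Block nt T) × Channel nr nt × Block nr T |
      MLDecides p.2.1 p.1 (received p.2.1 (p.1 i) + p.2.2) i} := by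
    simp only [MLDecides, Set.ofPred_and, Set.ofPred_forall]
    refine (MeasurableSet.iInter fun j => ?_).inter
      (MeasurableSet.iInter fun j => MeasurableSet.iInter fun _ => ?_)
    · exact measurableSet_le (continuous_energy_error i i).measurable
        (continuous_energy_error i j).measurable
    · exact measurableSet_lt (continuous_energy_error i i).measurable
        (continuous_energy_error i j).measurable
  exact h.compl

/-- Error probability of the code `X` on the channel `H`, averaged over messages and noise. -/
noncomputable def condError {nr nt T M : ℕ} (X : Fin M → Block nt T) (H : Channel nr nt) : ENNReal :=
  (∑ i, gaussianBlock nr T 1 {W | ¬ MLDecides H X (received H (X i) + W) i}) / M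

theorem measurable_condError_uncurry {nr nt T M : ℕ} :
    Measurable fun p : (Fin M → Block nt T) × Channel nr nt => condError p.1 p.2 := by
  unfold condError
  refine Measurable.div_const (Finset.measurable_sum _ fun i _ => ?_) _
  have h : MeasurableSet {q : ((Fin M → Block nt T) × Channel nr nt) × Block nr T |
      ¬ MLDecides q.1.2 q.1.1 (received q.1.2 (q.1.1 i) + q.2) i} :=
    (measurableSet_error i).preimage (f := fun q : ((Fin M → Block nt T) × Channel nr nt) ×
      Block nr T => (q.1.1, q.1.2, q.2)) (by fun_prop)
  exact measurable_measure_prodMk_left h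

theorem measurable_condError {nr nt T M : ℕ} (X : Fin M → Block nt T) :
    Measurable fun H : Channel nr nt => condError X H :=
  Measurable.of_uncurry_left (f := condError) measurable_condError_uncurry

theorem condError_le_one {nr nt T M : ℕ} (X : Fin M → Block nt T) (H : Channel nr nt) :
    condError X H ≤ 1 := by
  unfold condError
  refine ENNReal.div_le_of_le_mul ?_
  refine (Finset.sum_le_card_nsmul _ _ 1 fun i _ => prob_le_one).trans ?_
  simp

theorem ofReal_errorProb {nr nt T M : ℕ} (μ : Measure (Channel nr nt)) [IsProbabilityMeasure μ]
    (hM : 0 < M) (X : Fin M → Block nt T) :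
    ENNReal.ofReal (errorProb μ X) = ∫⁻ H, condError X H ∂μ := by
  have hsec : ∀ i, MeasurableSet {p : Channel nr nt × Block nr T |
      ¬ MLDecides p.1 X (received p.1 (X i) + p.2) i} := fun i =>
    (measurableSet_error i).preimage (f := fun p => (X, p)) (by fun_prop)
  have hmeas : ∀ i, Measurable fun H : Channel nr nt => gaussianBlock nr T 1
      {W | ¬ MLDecides H X (received H (X i) + W) i} := fun i =>
    measurable_measure_prodMk_left (hsec i)
  unfold errorProb condError
  simp only [div_eq_mul_inv]
  rw [lintegral_mul_const _ (Finset.measurable_sum _ fun i _ => hmeas i),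
    lintegral_finsetSum _ fun i _ => hmeas i,
    ENNReal.ofReal_mul (Finset.sum_nonneg fun i _ => measureReal_nonneg),
    ENNReal.ofReal_inv_of_pos (by exact_mod_cast hM), ENNReal.ofReal_natCast,
    ENNReal.ofReal_sum_of_nonneg fun i _ => measureReal_nonneg]
  congr 1
  refine Finset.sum_congr rfl fun i _ => ?_
  rw [ofReal_measureReal, Measure.prod_apply (hsec i)]
  rfl

theorem errorProb_nonneg {nr nt T M : ℕ} (μ : Measure (Channel nr nt)) (X : Fin M → Block nt T) :
    0 ≤ errorProb μ X :=
  div_nonneg (Finset.sum_nonneg fun _ _ => measureReal_nonneg) (Nat.cast_nonneg _)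

/-! ### Converse for a given channel -/

theorem MLDecides.eq {nr nt T M : ℕ} {H : Channel nr nt} {X : Fin M → Block nt T}
    {Y : Block nr T} {i j : Fin M} (hi : MLDecides H X Y i) (hj : MLDecides H X Y j) : i = j := by
  rcases lt_trichotomy i j with h | h | h
  · exact absurd (hj.2 i h) (not_lt.2 (hi.1 j))
  · exact h
  · exact absurd (hi.2 j h) (not_lt.2 (hj.1 i))

/-- If the received codewords fall into few clusters of radius `κ`, then most messages cannot be
decoded correctly. -/
theorem one_le_condError_add {nr nt T M : ℕ} (hM : 0 < M) (H : Channel nr nt)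
    (X : Fin M → Block nt T) {ι : Type*} (cls : Fin M → ι) (G : Finset ι) (hG : ∀ i, cls i ∈ G)
    {κ : ℝ} (hκ : 0 < κ)
    (hcls : ∀ i j, cls i = cls j → energy (received H (X i) - received H (X j)) ≤ κ ^ 2) (R : ℝ) :
    1 ≤ condError X H + gaussianBlock nr T 1 {W | R ≤ energy W} +
      ENNReal.ofReal (Real.exp (κ * R + κ + κ ^ 2)) * (G.card / M) := by
  classical
  set γ := gaussianBlock nr T 1 with hγ
  set D : Fin M → Set (Block nr T) := fun i => {Y | MLDecides H X Y i} with hD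
  set E := ENNReal.ofReal (Real.exp (κ * R + κ + κ ^ 2)) with hE
  have hDm : ∀ i, MeasurableSet (D i) := by
    intro i
    have hc : ∀ j, Continuous fun Y : Block nr T => energy (Y - received H (X j)) := fun j =>
      continuous_energy.comp (continuous_id.sub continuous_const)
    simp only [hD, MLDecides, Set.ofPred_and, Set.ofPred_forall]
    exact (MeasurableSet.iInter fun j => measurableSet_le (hc i).measurable (hc j).measurable).inter
      (MeasurableSet.iInter fun j => MeasurableSet.iInter fun _ =>
        measurableSet_lt (hc i).measurable (hc j).measurable)
  have hrep : ∀ g : ι, ∃ c : Block nr T, ∀ i, cls i = g →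
      energy (received H (X i) - c) ≤ κ ^ 2 := by
    intro g
    by_cases h : ∃ j, cls j = g
    · obtain ⟨j, hj⟩ := h
      exact ⟨received H (X j), fun i hi => hcls i j (hi.trans hj.symm)⟩
    · exact ⟨0, fun i hi => absurd ⟨i, hi⟩ h⟩
  choose c hc using hrep
  -- Correct decoding of message `i` is compared with the same event seen from the centre of its
  -- cluster.
  have h1 : ∀ i, 1 ≤ γ {W | ¬ MLDecides H X (received H (X i) + W) i} +
      (γ {W | R ≤ energy W} + E * γ {W | c (cls i) + W ∈ D i}) := by
    intro i
    have hm : MeasurableSet {W | received H (X i) + W ∈ D i} :=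
      (hDm i).preimage (by fun_prop)
    have h2 := prob_add_prob_compl (μ := γ) hm
    rw [← h2, add_comm]
    gcongr
    · exact le_of_eq rfl
    · exact gaussianBlock_shift_le (hDm i) _ _ hκ (hc _ i rfl)
  -- Seen from a common centre, the decision regions of a cluster are disjoint events, so each
  -- cluster contributes at most one.
  have h2 : ∑ i, γ {W | c (cls i) + W ∈ D i} ≤ G.card := by
    rw [← Finset.sum_fiberwise_of_maps_to (fun i _ => hG i)]
    refine (Finset.sum_le_card_nsmul _ _ 1 fun g _ => ?_).trans (by simp)
    calc ∑ i with cls i = g, γ {W | c (cls i) + W ∈ D i}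
        = ∑ i with cls i = g, γ {W | c g + W ∈ D i} := by
          refine Finset.sum_congr rfl fun i hi => ?_
          rw [(Finset.mem_filter.1 hi).2]
      _ = γ (⋃ i ∈ Finset.univ.filter (fun i => cls i = g), {W | c g + W ∈ D i}) := by
          refine (measure_biUnion_finset ?_ fun i _ => (hDm i).preimage (by fun_prop)).symm
          intro i _ j _ hij
          refine Set.disjoint_left.2 fun W hi hj => hij ?_
          exact MLDecides.eq (show MLDecides H X (c g + W) i from hi)
            (show MLDecides H X (c g + W) j from hj)
      _ ≤ 1 := prob_le_one
  have h3 := Finset.sum_le_sum fun i (_ : i ∈ Finset.univ) => h1 i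
  simp only [Finset.sum_add_distrib, Finset.sum_const, Finset.card_univ, Fintype.card_fin,
    nsmul_eq_mul, mul_one, ← Finset.mul_sum] at h3
  have hM0 : (M : ENNReal) ≠ 0 := by exact_mod_cast hM.ne'
  have hMt : (M : ENNReal) ≠ ⊤ := ENNReal.natCast_ne_top M
  calc (1 : ENNReal) = M / M := (ENNReal.div_self hM0 hMt).symm
    _ ≤ (∑ i, γ {W | ¬ MLDecides H X (received H (X i) + W) i} +
        (M * γ {W | R ≤ energy W} + E * G.card)) / M := by
        refine ENNReal.div_le_div_right (h3.trans ?_) _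
        gcongr
    _ = _ := by
        rw [ENNReal.add_div, ENNReal.add_div, mul_comm (M : ENNReal), mul_div_assoc,
          ENNReal.div_self hM0 hMt, mul_one, mul_div_assoc, ← add_assoc]
        rfl

theorem energy_received_le {nr nt T : ℕ} {H : Channel nr nt} {x : ℝ} (hx : 0 ≤ x)
    (hH : ∀ l, phi H l ≤ x) (X : Block nt T) : energy (received H X) ≤ x * energy X := by
  classical
  obtain ⟨V, lam, -, hV, hrec, hprod, -⟩ := exists_spectral H
  have h1 : ∀ i, lam i ≤ x := by
    intro i
    by_contra hi
    -- For the indicator of `y ≤ x`, the product over `phi` is one while a single `lam i > x` would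
    -- make the other product zero.
    have h2 := hprod (fun y => if y ≤ x then 1 else 0) (by simp [hx])
    rw [Finset.prod_eq_zero (Finset.mem_univ i) (by simp [hi]),
      Finset.prod_eq_one fun l _ => by simp [hH l]] at h2
    exact zero_ne_one h2
  rw [hrec, ← hV]
  unfold energy
  rw [Finset.mul_sum]
  refine Finset.sum_le_sum fun i _ => ?_
  exact mul_le_mul_of_nonneg_right (h1 i) (Finset.sum_nonneg fun t _ => by positivity)

theorem floor_mem_Icc_of_abs_le {x A : ℝ} (h : |x| ≤ A) : ⌊x⌋ ∈ Finset.Icc ⌊-A⌋ ⌊A⌋ := by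
  rw [abs_le] at h
  exact Finset.mem_Icc.2 ⟨Int.floor_le_floor h.1, Int.floor_le_floor h.2⟩

theorem card_Icc_floor_le {A : ℝ} (hA : 0 ≤ A) :
    ((Finset.Icc ⌊-A⌋ ⌊A⌋).card : ℝ) ≤ 2 * A + 2 := by
  rw [Int.card_Icc]
  have h1 : (⌊A⌋ : ℝ) ≤ A := Int.floor_le A
  have h2 : -A < ⌊-A⌋ + 1 := Int.lt_floor_add_one (-A)
  have h3 : ⌊-A⌋ ≤ ⌊A⌋ := Int.floor_le_floor (by linarith)
  have h4 : (((⌊A⌋ + 1 - ⌊-A⌋).toNat : ℤ) : ℝ) = ⌊A⌋ + 1 - ⌊-A⌋ := by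
    rw [Int.toNat_of_nonneg (by omega)]; push_cast; rfl
  have h5 : (((⌊A⌋ + 1 - ⌊-A⌋).toNat : ℕ) : ℝ) = ⌊A⌋ + 1 - ⌊-A⌋ := by exact_mod_cast h4
  rw [h5]
  linarith

theorem abs_sub_le_of_floor_div_eq {x y b : ℝ} (hb : 0 < b) (h : ⌊x / b⌋ = ⌊y / b⌋) :
    (x - y) ^ 2 ≤ b ^ 2 := by
  have h1 := Int.abs_sub_lt_one_of_floor_eq_floor h
  rw [← sub_div, abs_div, abs_of_pos hb, div_lt_one hb] at h1
  exact sq_le_sq' (by linarith [neg_abs_le (x - y)]) (by linarith [le_abs_self (x - y)])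

/-- Codewords of bounded energy fall into few clusters after transmission. -/
theorem exists_clusters (nt T : ℕ) : ∃ C : ℝ, 0 < C ∧
    ∀ {nr M : ℕ} (H : Channel nr nt) (X : Fin M → Block nt T) (v : ℝ), 0 ≤ v →
      (∀ i, energy (X i) ≤ v) → ∃ (cls : Fin M → (Fin nt × Fin T → ℤ × ℤ))
        (G : Finset (Fin nt × Fin T → ℤ × ℤ)), (∀ i, cls i ∈ G) ∧
        (∀ i j, cls i = cls j → energy (received H (X i) - received H (X j)) ≤ 1 ^ 2) ∧
        (G.card : ℝ) ≤ C * (∏ l, (1 + v * phi H l)) ^ T := by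
  -- Cell side for the real and imaginary parts: the `nt T` complex coordinates each add at most `2
  -- b ^ 2` to the squared distance, which totals at most 1.
  set b : ℝ := 1 / (2 * (nt * T + 1)) with hb
  have hb0 : 0 < b := by positivity
  have hb1 : b ≤ 1 := by
    rw [hb, div_le_one (by positivity)]
    have : (0 : ℝ) ≤ nt * T := by positivity
    linarith
  have hbsum : (nt * T : ℝ) * (2 * b ^ 2) ≤ 1 := by
    have h1 : (nt * T : ℝ) * b ≤ 1 / 2 := by
      rw [hb, mul_one_div, div_le_div_iff₀ (by positivity) (by norm_num)]
      linarith
    nlinarith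
  refine ⟨(8 / b ^ 2) ^ (nt * T), by positivity, ?_⟩
  intro nr M H X v hv hX
  obtain ⟨V, lam, hlam, hV, hrec, hprod, -⟩ := exists_spectral H
  -- Range of the rescaled coordinates in units of `b`. A complex coordinate meets at most `(2 A +
  -- 2) ^ 2 ≤ 8 (A ^ 2 + 1)` cells, and the product over `l` and `t` rebuilds the determinant to the
  -- power `T`.
  set A : Fin nt → ℝ := fun l => √(lam l * v) / b with hA
  have hA0 : ∀ l, 0 ≤ A l := fun l => by positivity
  set Z : Fin M → Block nt T := fun i => V * Matrix.of (X i) with hZ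
  refine ⟨fun i p => (⌊√(lam p.1) * (Z i p.1 p.2).re / b⌋, ⌊√(lam p.1) * (Z i p.1 p.2).im / b⌋),
    Fintype.piFinset fun p => Finset.Icc ⌊-A p.1⌋ ⌊A p.1⌋ ×ˢ Finset.Icc ⌊-A p.1⌋ ⌊A p.1⌋,
    fun i => ?_, fun i j hij => ?_, ?_⟩
  · rw [Fintype.mem_piFinset]
    rintro ⟨l, t⟩
    have h1 : ‖Z i l t‖ ≤ √v := by
      refine Real.le_sqrt_of_sq_le ?_
      exact (sq_norm_le_energy (Z i) l t).trans ((hV T (X i)).le.trans (hX i))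
    have h2 : ∀ x : ℝ, |x| ≤ ‖Z i l t‖ → |√(lam l) * x / b| ≤ A l := by
      intro x hx
      rw [abs_div, abs_of_pos hb0, abs_mul, abs_of_nonneg (Real.sqrt_nonneg _)]
      have := hx.trans h1
      simp only [hA]
      rw [Real.sqrt_mul (hlam l)]
      gcongr
    exact Finset.mem_product.2 ⟨floor_mem_Icc_of_abs_le (h2 _ (Complex.abs_re_le_norm _)),
      floor_mem_Icc_of_abs_le (h2 _ (Complex.abs_im_le_norm _))⟩
  · rw [received_sub, hrec, one_pow]
    have hZsub : ∀ l t, (V * Matrix.of (X i - X j)) l t = Z i l t - Z j l t := by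
      intro l t
      have : V * Matrix.of (X i - X j) = V * Matrix.of (X i) - V * Matrix.of (X j) :=
        Matrix.mul_sub V (Matrix.of (X i)) (Matrix.of (X j))
      rw [this]; rfl
    have h1 : ∀ l t, lam l * ‖(V * Matrix.of (X i - X j)) l t‖ ^ 2 ≤ 2 * b ^ 2 := by
      intro l t
      have h2 := congrFun hij (l, t)
      rw [Prod.mk.injEq] at h2
      have h3 := abs_sub_le_of_floor_div_eq hb0 h2.1
      have h4 := abs_sub_le_of_floor_div_eq hb0 h2.2
      rw [← mul_sub, mul_pow, Real.sq_sqrt (hlam l)] at h3 h4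
      rw [hZsub, Complex.sq_norm, Complex.normSq_apply, Complex.sub_re, Complex.sub_im]
      simp only at h3 h4
      nlinarith
    calc _ = ∑ l, ∑ t, lam l * ‖(V * Matrix.of (X i - X j)) l t‖ ^ 2 := by
          simp only [Finset.mul_sum]
      _ ≤ ∑ l : Fin nt, ∑ t : Fin T, 2 * b ^ 2 :=
          Finset.sum_le_sum fun l _ => Finset.sum_le_sum fun t _ => h1 l t
      _ = (nt * T : ℝ) * (2 * b ^ 2) := by simp [mul_assoc]
      _ ≤ 1 := hbsum
  · rw [Fintype.card_piFinset]
    simp only [Finset.card_product]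
    push_cast
    have h1 : ∀ l, ((Finset.Icc ⌊-A l⌋ ⌊A l⌋).card : ℝ) * (Finset.Icc ⌊-A l⌋ ⌊A l⌋).card ≤
        8 / b ^ 2 * (1 + v * lam l) := by
      intro l
      have h2 := card_Icc_floor_le (hA0 l)
      have h3 : A l ^ 2 = lam l * v / b ^ 2 := by
        rw [hA, div_pow, Real.sq_sqrt (mul_nonneg (hlam l) hv)]
      have h4 : 1 ≤ 1 / b ^ 2 := by
        rw [le_div_iff₀ (by positivity)]; nlinarith
      have h5 : 8 / b ^ 2 * (1 + v * lam l) = 8 * (1 / b ^ 2) + 8 * (lam l * v / b ^ 2) := by ring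
      rw [h5, ← h3]
      have h6 : (0 : ℝ) ≤ (Finset.Icc ⌊-A l⌋ ⌊A l⌋).card := Nat.cast_nonneg _
      have h7 := hA0 l
      nlinarith [sq_nonneg (A l - 1)]
    calc _ ≤ ∏ p : Fin nt × Fin T, 8 / b ^ 2 * (1 + v * lam p.1) :=
          Finset.prod_le_prod (fun p _ => by positivity) fun p _ => h1 p.1
      _ = _ := by
          rw [Finset.prod_mul_distrib, Finset.prod_const, Finset.card_univ, Fintype.card_prod,
            Fintype.card_fin, Fintype.card_fin, Fintype.prod_prod_type,
            ← hprod (fun x => 1 + v * x) (by simp), ← Finset.prod_pow]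
          simp

/-! ### Converse -/

theorem exists_noise_radius (n T : ℕ) :
    ∃ R : ℝ, gaussianBlock n T 1 {W | R ≤ energy W} ≤ ENNReal.ofReal (1 / 8) := by
  have h1 : Tendsto (fun R : ℝ => (2 : ℝ) ^ (n * T) * Real.exp (-R / 2)) atTop (𝓝 0) := by
    have h2 : Tendsto (fun R : ℝ => Real.exp (-(R / 2))) atTop (𝓝 0) :=
      Real.tendsto_exp_neg_atTop_nhds_zero.comp (tendsto_id.atTop_div_const two_pos)
    simpa [neg_div] using h2.const_mul ((2 : ℝ) ^ (n * T))
  obtain ⟨R, hR⟩ := (h1.eventually_le_const (show (0 : ℝ) < 1 / 8 by norm_num)).exists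
  refine ⟨R, (gaussianBlock_energy_tail one_ne_zero R).trans (ENNReal.ofReal_le_ofReal ?_)⟩
  simpa using hR

/-- Numerically, `1/8 + 1/8 + 5/8 < 1`. The allowance `5/8` is what the case of two messages needs.
-/
theorem inv_eight_le_of_one_le_add {e a b : ENNReal} {β : ℝ} (h : 1 ≤ e + a + b)
    (ha : a ≤ ENNReal.ofReal (1 / 8)) (hb : b ≤ ENNReal.ofReal β) (hβ : β ≤ 5 / 8) :
    ENNReal.ofReal (1 / 8) ≤ e := by
  by_contra hlt
  rw [not_le] at hlt
  have h1 : e + a + b < ENNReal.ofReal (1 / 8) + ENNReal.ofReal (1 / 8) + ENNReal.ofReal (5 / 8) :=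
      by
    refine ENNReal.add_lt_add_of_lt_of_le ?_ ?_ (hb.trans (ENNReal.ofReal_le_ofReal hβ))
    · exact ne_top_of_le_ne_top ENNReal.ofReal_ne_top hb
    · refine ENNReal.add_lt_add_of_lt_of_le ?_ hlt ha
      exact ne_top_of_le_ne_top ENNReal.ofReal_ne_top ha
  rw [← ENNReal.ofReal_add (by norm_num) (by norm_num),
    ← ENNReal.ofReal_add (by norm_num) (by norm_num)] at h1
  have h2 := h.trans_lt h1
  norm_num at h2

theorem mul_measure_le_lintegral {Ω : Type*} [MeasurableSpace Ω] {μ : Measure Ω}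
    {f : Ω → ENNReal} (hf : Measurable f) {B : Set Ω} {c : ENNReal} (h : ∀ x ∈ B, c ≤ f x) :
    c * μ B ≤ ∫⁻ x, f x ∂μ :=
  (mul_le_mul_right (measure_mono h) c).trans (mul_meas_ge_le_lintegral hf c)

/-- Below the scale at which the channel supports the rate, decoding fails with a probability
bounded from below: case of positive multiplexing gain. -/
theorem eventually_inv_eight_le_condError_of_pos {nr nt T : ℕ} (hT : 1 ≤ T) {r : ℝ}
    {α : Fin (min nr nt) → ℝ} (hα : ∑ l, max (1 - α l) 0 < r) :
    ∃ η : ℝ, 0 < η ∧ ∀ᶠ snr : ℝ in atTop, ∀ (M : ℕ) (X : Fin M → Block nt T), 2 ≤ M →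
      snr ^ (T * (r - η)) ≤ M → (∀ i, energy (X i) ≤ snr ^ (1 + η)) →
      ∀ H : Channel nr nt, (∀ l, phi H l ≤ snr ^ (-α l)) →
        ENNReal.ofReal (1 / 8) ≤ condError X H := by
  obtain ⟨C, hC0, hC⟩ := exists_clusters nt T
  obtain ⟨R, hR⟩ := exists_noise_radius nr T
  set S := ∑ l, max (1 - α l) 0 with hS
  -- Then `S + n η = r - 3 η`, with `n = min nr nt`, so the number of clusters is polynomially
  -- smaller than `M ≥ snr ^ (T (r - η))`.
  set η : ℝ := (r - S) / ((min nr nt : ℕ) + 3) with hη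
  have hη0 : 0 < η := div_pos (by linarith) (by positivity)
  have hηm : ((min nr nt : ℕ) + 3) * η = r - S := by rw [hη]; field_simp
  set C' : ℝ := Real.exp (1 * R + 1 + 1 ^ 2) * (C * 2 ^ ((min nr nt : ℕ) * T)) with hC'
  refine ⟨η, hη0, ?_⟩
  filter_upwards [eventually_gt_atTop 1, eventually_const_mul_rpow_le (8 * C')
    (show (T : ℝ) * (S + (min nr nt : ℕ) * η) < T * (r - η) by
      have : (1 : ℝ) ≤ T := by exact_mod_cast hT
      have h2 : S + (min nr nt : ℕ) * η = r - η - 2 * η := by linarith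
      nlinarith)] with snr hsnr hbig M X hM2 hM hX H hH
  have hs0 : 0 < snr := by linarith
  obtain ⟨cls, G, hG, hcls, hcard⟩ := hC H X (snr ^ (1 + η)) (by positivity) hX
  have hM0 : 0 < M := by omega
  have hM0' : (0 : ℝ) < M := by exact_mod_cast hM0
  have hprod : ∏ l, (1 + snr ^ (1 + η) * phi H l) ≤ 2 ^ (min nr nt : ℕ) * snr ^ (S +
      (min nr nt : ℕ) * η) := by
    calc ∏ l, (1 + snr ^ (1 + η) * phi H l)
        ≤ ∏ l, 2 * snr ^ (max (1 - α l) 0 + η) := by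
          refine Finset.prod_le_prod (fun l _ => ?_) fun l _ => ?_
          · have := phi_nonneg H l; positivity
          · have h1 : 1 ≤ snr ^ (max (1 - α l) 0 + η) :=
              Real.one_le_rpow hsnr.le (by have := le_max_right (1 - α l) 0; linarith)
            have h2 : snr ^ (1 + η) * phi H l ≤ snr ^ (max (1 - α l) 0 + η) := by
              calc _ ≤ snr ^ (1 + η) * snr ^ (-α l) := by gcongr; exact hH l
                _ = snr ^ (1 + η + -α l) := (Real.rpow_add hs0 _ _).symm
                _ ≤ _ := Real.rpow_le_rpow_of_exponent_le hsnr.le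
                    (by have := le_max_left (1 - α l) 0; linarith)
            linarith
      _ = _ := by
          rw [Finset.prod_mul_distrib, Finset.prod_const, Finset.card_univ, Fintype.card_fin,
            ← Real.rpow_sum_of_pos hs0, Finset.sum_add_distrib, Finset.sum_const,
            Finset.card_univ, Fintype.card_fin, nsmul_eq_mul]
  have hcard' : (G.card : ℝ) ≤ C * 2 ^ ((min nr nt : ℕ) * T) * snr ^ (T * (S +
      (min nr nt : ℕ) * η)) := by
    have h1 : 0 ≤ ∏ l, (1 + snr ^ (1 + η) * phi H l) :=
      Finset.prod_nonneg fun l _ => by have := phi_nonneg H l; positivity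
    calc (G.card : ℝ) ≤ C * (2 ^ (min nr nt : ℕ) * snr ^ (S + (min nr nt : ℕ) * η)) ^ T :=
        hcard.trans (by gcongr)
      _ = _ := by
          rw [mul_pow, ← pow_mul, ← Real.rpow_natCast (snr ^ _), ← Real.rpow_mul hs0.le]
          ring_nf
  refine inv_eight_le_of_one_le_add (one_le_condError_add hM0 H X cls G hG one_pos hcls R) hR
    (β := 1 / 8) ?_ (by norm_num)
  rw [← ENNReal.ofReal_natCast G.card, ← ENNReal.ofReal_natCast M,
    ← ENNReal.ofReal_div_of_pos hM0', ← ENNReal.ofReal_mul (by positivity)]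
  refine ENNReal.ofReal_le_ofReal ?_
  rw [mul_div_assoc', div_le_iff₀ hM0']
  calc _ ≤ Real.exp (1 * R + 1 + 1 ^ 2) * (C * 2 ^ ((min nr nt : ℕ) * T) * snr ^ (T * (S +
      (min nr nt : ℕ) * η))) := by gcongr
    _ = 1 / 8 * (8 * C' * snr ^ (T * (S + (min nr nt : ℕ) * η))) := by rw [hC']; ring
    _ ≤ 1 / 8 * M := by
        gcongr
        exact hbig.trans hM

/-- Same as `eventually_inv_eight_le_condError_of_pos` for zero multiplexing gain. -/
theorem eventually_inv_eight_le_condError_of_zero {nr nt T : ℕ} [Nonempty (Fin (min nr nt))]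
    {α : Fin (min nr nt) → ℝ} (hα : ∀ l, 1 < α l) :
    ∃ η : ℝ, 0 < η ∧ ∀ᶠ snr : ℝ in atTop, ∀ (M : ℕ) (X : Fin M → Block nt T), 2 ≤ M →
      (∀ i, energy (X i) ≤ snr ^ (1 + η)) →
      ∀ H : Channel nr nt, (∀ l, phi H l ≤ snr ^ (-α l)) →
        ENNReal.ofReal (1 / 8) ≤ condError X H := by
  obtain ⟨R, hR⟩ := exists_noise_radius nr T
  -- With one cluster and `M ≥ 2`, the last term is at most `(5/4) / 2 = 5/8`, provided the radius
  -- is small.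
  obtain ⟨κ, hκ, hκ0⟩ : ∃ κ : ℝ, Real.exp (κ * R + κ + κ ^ 2) ≤ 5 / 4 ∧ 0 < κ := by
    have h1 : Tendsto (fun κ : ℝ => Real.exp (κ * R + κ + κ ^ 2)) (𝓝[>] 0) (𝓝 1) := by
      have : Continuous fun κ : ℝ => Real.exp (κ * R + κ + κ ^ 2) := by fun_prop
      simpa using (this.tendsto 0).mono_left nhdsWithin_le_nhds
    exact ((h1.eventually_le_const (show (1 : ℝ) < 5 / 4 by norm_num)).and
      self_mem_nhdsWithin).exists
  obtain ⟨l₀, hl₀⟩ := Finite.exists_min α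
  -- This choice makes `snr ^ (-α l₀) * snr ^ (1 + η) = snr ^ (-η)`, so that all received words
  -- eventually lie within `κ`.
  have hη0 : 0 < (α l₀ - 1) / 2 := by have := hα l₀; linarith
  refine ⟨(α l₀ - 1) / 2, hη0, ?_⟩
  set η := (α l₀ - 1) / 2 with hη
  filter_upwards [eventually_gt_atTop 1, eventually_const_mul_rpow_le (4 / κ ^ 2)
    (show -η < 0 by linarith)] with snr hsnr hbig M X hM hX H hH
  have hs0 : 0 < snr := by linarith
  have hM0 : 0 < M := by omega
  have hM0' : (2 : ℝ) ≤ M := by exact_mod_cast hM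
  have hφ : ∀ l, phi H l ≤ snr ^ (-α l₀) := fun l => (hH l).trans
    (Real.rpow_le_rpow_of_exponent_le hsnr.le (by have := hl₀ l; linarith))
  have hcls : ∀ i j, () = () → energy (received H (X i) - received H (X j)) ≤ κ ^ 2 := by
    intro i j _
    rw [received_sub]
    have h1 : energy (X i - X j) ≤ 4 * snr ^ (1 + η) := by
      have := energy_add_le (X i) (-X j) one_pos
      rw [← sub_eq_add_neg, energy_neg] at this
      have := hX i
      have := hX j
      linarith
    calc _ ≤ snr ^ (-α l₀) * energy (X i - X j) := energy_received_le (by positivity) hφ _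
      _ ≤ snr ^ (-α l₀) * (4 * snr ^ (1 + η)) := by gcongr
      _ = κ ^ 2 * (4 / κ ^ 2 * snr ^ (-η)) := by
          have : snr ^ (-η) = snr ^ (-α l₀) * snr ^ (1 + η) := by
            rw [← Real.rpow_add hs0]; congr 1; rw [hη]; ring
          rw [this]; field_simp
      _ ≤ κ ^ 2 * snr ^ (0 : ℝ) := by gcongr
      _ = κ ^ 2 := by rw [Real.rpow_zero, mul_one]
  refine inv_eight_le_of_one_le_add
    (one_le_condError_add hM0 H X (fun _ => ()) {()} (by simp) hκ0 hcls R) hR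
    (β := 5 / 8) ?_ le_rfl
  rw [← ENNReal.ofReal_natCast (Finset.card _), ← ENNReal.ofReal_natCast M,
    ← ENNReal.ofReal_div_of_pos (by linarith), ← ENNReal.ofReal_mul (by positivity)]
  refine ENNReal.ofReal_le_ofReal ?_
  rw [Finset.card_singleton, Nat.cast_one, mul_one_div, div_le_iff₀ (by linarith)]
  linarith

/-- The error is at least `1/8` on a box of nearly optimal probability. The threshold on `snr` does
not depend on the code, and the slack `η` in size and energy admits random codewords that violate
the power constraint. -/
theorem eventually_rpow_le_errorProb {nr nt : ℕ} {μ : Measure (Channel nr nt)}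
    [IsProbabilityMeasure μ] {k : Fin (min nr nt) → ℝ} (hzero : NearZeroBehavior μ k)
    (s : Fin (min nr nt)) {r : ℝ} (hsr : (s : ℝ) ≤ r) (hrs : r < (s : ℝ) + 1) {T : ℕ}
    (hT : 1 ≤ T) {δ : ℝ} (hδ : 0 < δ) :
    ∃ η : ℝ, 0 < η ∧ ∀ᶠ snr : ℝ in atTop, ∀ (M : ℕ) (X : Fin M → Block nt T), 2 ≤ M →
      snr ^ (T * (r - η)) ≤ M → (∀ i, energy (X i) ≤ snr ^ (1 + η)) →
      snr ^ (-segment k s r - δ) ≤ errorProb μ X := by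
  obtain ⟨α, hα, hsum, hr⟩ := exists_scale k s hsr hrs (show 0 < δ / 3 by positivity)
  have hne : Nonempty (Fin (min nr nt)) := ⟨s⟩
  obtain ⟨η, hη, h⟩ : ∃ η : ℝ, 0 < η ∧ ∀ᶠ snr : ℝ in atTop, ∀ (M : ℕ) (X : Fin M → Block nt T), 2 ≤
      M →
      snr ^ (T * (r - η)) ≤ M → (∀ i, energy (X i) ≤ snr ^ (1 + η)) →
      ∀ H : Channel nr nt, (∀ l, phi H l ≤ snr ^ (-α l)) →
        ENNReal.ofReal (1 / 8) ≤ condError X H := by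
    rcases hr with ⟨-, h⟩ | ⟨-, h⟩
    · exact eventually_inv_eight_le_condError_of_pos hT h
    · obtain ⟨η, hη, h'⟩ := eventually_inv_eight_le_condError_of_zero (nr := nr) (nt := nt) (T :=
        T) h
      exact ⟨η, hη, h'.mono fun snr h M X hM _ hX => h M X hM hX⟩
  refine ⟨η, hη, ?_⟩
  filter_upwards [h, eventually_gt_atTop 1,
    (hzero α hα).eventually_rpow_le (show 0 < δ / 3 by positivity),
    eventually_const_mul_rpow_le 8 (show -segment k s r - δ < -segment k s r - 2 * (δ / 3) by
      linarith)] with snr h hsnr h1 h2 M X hM2 hM hX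
  have hs0 : 0 < snr := by linarith
  have h3 := mul_measure_le_lintegral (μ := μ) (measurable_condError X)
    (B := {H | ∀ l, phi H l ≤ snr ^ (-α l)}) (h M X hM2 hM hX)
  rw [← ofReal_errorProb μ (by omega) X, ← ofReal_measureReal, ← ENNReal.ofReal_mul (by norm_num),
    ENNReal.ofReal_le_ofReal_iff (errorProb_nonneg μ X)] at h3
  have h4 : snr ^ (-segment k s r - 2 * (δ / 3)) ≤
      snr ^ (-(∑ l, (k l + 1) * max (α l) 0) - δ / 3) :=
    Real.rpow_le_rpow_of_exponent_le hsnr.le (by linarith)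
  linarith

/-! ### Random codes -/

/-- Union bound over the competing codewords. Ties count as errors, so the tie-breaking rule is
immaterial. -/
theorem measure_error_le {nr nt T M : ℕ} (X : Fin M → Block nt T) (H : Channel nr nt) (i : Fin M) :
    gaussianBlock nr T 1 {W | ¬ MLDecides H X (received H (X i) + W) i} ≤
      ∑ j ∈ Finset.univ.erase i,
        ENNReal.ofReal (Real.exp (-(4⁻¹ * energy (received H (X j - X i))))) := by
  have hsub : {W | ¬ MLDecides H X (received H (X i) + W) i} ⊆
      ⋃ j ∈ Finset.univ.erase i, {W | energy (W + received H (X i - X j)) ≤ energy W} := by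
    intro W hW
    have h1 : ∃ j, j ≠ i ∧ energy (received H (X i) + W - received H (X j)) ≤
        energy (received H (X i) + W - received H (X i)) := by
      by_contra! hcon
      refine hW ⟨fun j => ?_, fun j hj => hcon j hj.ne⟩
      by_cases hj : j = i
      · rw [hj]
      · exact (hcon j hj).le
    obtain ⟨j, hj, hle⟩ := h1
    simp only [Set.mem_iUnion]
    refine ⟨j, Finset.mem_erase.2 ⟨hj, Finset.mem_univ j⟩, ?_⟩
    have h2 : received H (X i) + W - received H (X j) = W + received H (X i - X j) := by
      rw [← received_sub]; abel
    rw [add_sub_cancel_left, h2] at hle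
    exact hle
  refine (measure_mono hsub).trans ((measure_biUnion_finset_le _ _).trans ?_)
  refine Finset.sum_le_sum fun j _ => (gaussianBlock_pairwise_error _).trans (le_of_eq ?_)
  have h3 : energy (received H (X i - X j)) = energy (received H (X j - X i)) := by
    rw [← received_sub, ← received_sub, ← energy_neg, neg_sub]
  rw [h3]
  congr 2
  ring

/-- Rotating by `V` preserves the Gaussian law and makes the channel diagonal, so the mean
factorizes. Domination by twice a Gaussian is all that is asked of `ν`, so that the conditioned
ensemble is included. -/
theorem lintegral_pairwise_le {nr nt T : ℕ} (H : Channel nr nt) {ν : Measure (Block nt T)}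
    {v : NNReal} (hv : v ≠ 0) (hν : ν ≤ (2 : ENNReal) • gaussianBlock nt T v) (x : Block nt T) :
    ∫⁻ y, ENNReal.ofReal (Real.exp (-(4⁻¹ * energy (received H (y - x))))) ∂ν ≤
      2 * ENNReal.ofReal ((∏ l, (1 + v / 4 * phi H l)) ^ T)⁻¹ := by
  refine (lintegral_mono' hν le_rfl).trans ?_
  rw [lintegral_smul_measure, smul_eq_mul]
  gcongr
  obtain ⟨V, lam, hlam, hV, hrec, hprod, -⟩ := exists_spectral H
  let A : Block nt T →ₗ[ℝ] Block nt T :=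
    { toFun := fun X => V * Matrix.of X
      map_add' := fun X Y => Matrix.mul_add V (Matrix.of X) (Matrix.of Y)
      map_smul' := fun c X => Matrix.mul_smul V c (Matrix.of X) }
  have hA : MeasurePreserving A (gaussianBlock nt T v) (gaussianBlock nt T v) :=
    measurePreserving_gaussianBlock_of_energy hv A (hV T)
  have h1 : ∀ y, energy (received H (y - x)) = ∑ i, lam i * ∑ t, ‖A y i t - A x i t‖ ^ 2 := by
    intro y
    rw [hrec]
    have : V * Matrix.of (y - x) = V * Matrix.of y - V * Matrix.of x :=
      Matrix.mul_sub V (Matrix.of y) (Matrix.of x)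
    rw [this]
    rfl
  simp only [h1]
  rw [hA.lintegral_comp (f := fun y => ENNReal.ofReal
    (Real.exp (-(4⁻¹ * ∑ i, lam i * ∑ t, ‖y i t - A x i t‖ ^ 2)))) (by fun_prop)]
  refine (lintegral_exp_gaussianBlock_le hv (by norm_num) hlam (A x)).trans (le_of_eq ?_)
  rw [hprod (fun y => 1 + 4⁻¹ * v * y) (by simp), Finset.prod_congr rfl fun l _ =>
    (by ring : 1 + 4⁻¹ * (v : ℝ) * phi H l = 1 + v / 4 * phi H l)]

theorem lintegral_pi_pair {E : Type*} [MeasurableSpace E] {M : ℕ} (ν : Measure E)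
    [IsProbabilityMeasure ν] {F : E × E → ENNReal} (hF : Measurable F) {i j : Fin M}
    (hij : i ≠ j) :
    ∫⁻ X : Fin M → E, F (X i, X j) ∂(Measure.pi fun _ => ν) = ∫⁻ x, ∫⁻ y, F (x, y) ∂ν ∂ν := by
  have hind : IndepFun (fun X : Fin M → E => X i) (fun X => X j) (Measure.pi fun _ => ν) :=
    (iIndepFun_pi (X := fun _ : Fin M => (id : E → E)) fun _ => aemeasurable_id).indepFun hij
  have hmap := (indepFun_iff_map_prod_eq_prod_map_map (measurable_pi_apply i).aemeasurable
    (measurable_pi_apply j).aemeasurable).1 hind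
  have he : ∀ i : Fin M, (Measure.pi fun _ : Fin M => ν).map (fun X => X i) = ν := fun i =>
    (measurePreserving_eval (fun _ : Fin M => ν) i).map_eq
  rw [he, he] at hmap
  rw [← lintegral_prod _ hF.aemeasurable, ← hmap,
    lintegral_map hF ((measurable_pi_apply i).prodMk (measurable_pi_apply j))]

theorem measurable_exp_energy_received {nr nt T : ℕ} (H : Channel nr nt) :
    Measurable fun p : Block nt T × Block nt T =>
      ENNReal.ofReal (Real.exp (-(4⁻¹ * energy (received H (p.2 - p.1))))) := by
  have hF : Continuous fun p : Block nt T × Block nt T => energy (received H (p.2 - p.1)) :=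
    continuous_energy.comp
      (continuous_received continuous_const (continuous_snd.sub continuous_fst))
  exact (Real.measurable_exp.comp (hF.measurable.const_mul 4⁻¹).neg).ennreal_ofReal

theorem lintegral_condError_le {nr nt T M : ℕ} (H : Channel nr nt) {ν : Measure (Block nt T)}
    [IsProbabilityMeasure ν] {v : NNReal} (hv : v ≠ 0)
    (hν : ν ≤ (2 : ENNReal) • gaussianBlock nt T v) :
    ∫⁻ X : Fin M → Block nt T, condError X H ∂(Measure.pi fun _ => ν) ≤
      M * (2 * ENNReal.ofReal ((∏ l, (1 + v / 4 * phi H l)) ^ T)⁻¹) := by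
  generalize hq : 2 * ENNReal.ofReal ((∏ l, (1 + v / 4 * phi H l)) ^ T)⁻¹ = q
  obtain ⟨F, hF⟩ : ∃ F : Block nt T × Block nt T → ENNReal, F = fun p =>
    ENNReal.ofReal (Real.exp (-(4⁻¹ * energy (received H (p.2 - p.1))))) := ⟨_, rfl⟩
  have hFm : Measurable F := hF ▸ measurable_exp_energy_received H
  have hpair : ∀ i j : Fin M, i ≠ j →
      ∫⁻ X : Fin M → Block nt T, F (X i, X j) ∂(Measure.pi fun _ => ν) ≤ q := by
    intro i j hij
    rw [lintegral_pi_pair ν hFm hij]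
    calc _ ≤ ∫⁻ _ : Block nt T, q ∂ν := lintegral_mono fun x => by
          rw [hF, ← hq]; exact lintegral_pairwise_le H hv hν x
      _ = q := by simp
  have hmeas : ∀ i j : Fin M, Measurable fun X : Fin M → Block nt T => F (X i, X j) := fun i j =>
    hFm.comp ((measurable_pi_apply i).prodMk (measurable_pi_apply j))
  calc ∫⁻ X : Fin M → Block nt T, condError X H ∂(Measure.pi fun _ => ν)
      ≤ ∫⁻ X : Fin M → Block nt T, (∑ i, ∑ j ∈ Finset.univ.erase i, F (X i, X j)) *
          (M : ENNReal)⁻¹ ∂(Measure.pi fun _ => ν) := by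
        refine lintegral_mono fun X => ?_
        rw [← div_eq_mul_inv, hF]
        exact ENNReal.div_le_div_right (Finset.sum_le_sum fun i _ => measure_error_le X H i) _
    _ = (∑ i, ∑ j ∈ Finset.univ.erase i,
        ∫⁻ X : Fin M → Block nt T, F (X i, X j) ∂(Measure.pi fun _ => ν)) * (M : ENNReal)⁻¹ := by
        rw [lintegral_mul_const _ (Finset.measurable_sum _ fun i _ =>
          Finset.measurable_sum _ fun j _ => hmeas i j), lintegral_finsetSum _ fun i _ =>
          Finset.measurable_sum _ fun j _ => hmeas i j]
        simp only [lintegral_finsetSum _ fun j _ => hmeas _ j]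
    _ ≤ (∑ i : Fin M, ∑ j : Fin M, q) * (M : ENNReal)⁻¹ := by
        gcongr with i _
        refine (Finset.sum_le_sum fun j hj => hpair i j (Finset.ne_of_mem_erase hj).symm).trans ?_
        exact Finset.sum_le_sum_of_subset (Finset.erase_subset _ _)
    _ ≤ M * q := by
        simp only [Finset.sum_const, Finset.card_univ, Fintype.card_fin, nsmul_eq_mul]
        rw [mul_comm (M : ENNReal) (M * q), mul_assoc]
        exact (mul_le_mul_right (ENNReal.mul_inv_le_one _) _).trans (by rw [mul_one])

theorem HasMultiplexingGain.eventually {T : ℕ} (hT : 1 ≤ T) {M : ℝ → ℕ} {r : ℝ}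
    (hM : HasMultiplexingGain T M r) {η : ℝ} (hη : 0 < η) :
    ∀ᶠ snr : ℝ in atTop, snr ^ (T * (r - η)) ≤ M snr ∧ (M snr : ℝ) ≤ snr ^ (T * (r + η)) := by
  have hT0 : (0 : ℝ) < T := by exact_mod_cast hT
  have h : HasExponent (fun snr => (M snr : ℝ)) (-(T * r)) := by
    refine ⟨Eventually.of_forall fun snr => ?_, ?_⟩
    · have : 0 < M snr := lt_of_lt_of_le two_pos (hM.1 snr)
      exact Nat.cast_pos.2 this
    · rw [neg_neg]
      refine (hM.2.const_mul (T : ℝ)).congr fun snr => ?_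
      field_simp
  have hδ : 0 < T * η := by positivity
  filter_upwards [h.eventually_rpow_le hδ, h.eventually_le_rpow hδ] with snr h1 h2
  rw [neg_neg] at h1 h2
  rw [mul_sub, mul_add]
  exact ⟨h1, h2⟩

theorem measurable_lintegral_condError {nr nt T M : ℕ} (μ : Measure (Channel nr nt)) [SFinite μ] :
    Measurable fun X : Fin M → Block nt T => ∫⁻ H, condError X H ∂μ :=
  Measurable.lintegral_prod_right' (f := fun p : (Fin M → Block nt T) × Channel nr nt =>
    condError p.1 p.2) measurable_condError_uncurry

/-- The code is averaged first, for a fixed channel, and the result enters `eventually_lintegral_le`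
with `τ = T`. The bound `v ≥ snr / 4`, met by both ensembles in use, together with the `1/4` of the
pairwise error, produces `snr / 16`. -/
theorem eventually_lintegral_errorProb_le {nr nt : ℕ} {μ : Measure (Channel nr nt)}
    [IsProbabilityMeasure μ] {k : Fin (min nr nt) → ℝ} (hk : StrictMono k)
    (hzero : NearZeroBehavior μ k) (htail : ExponentialTails μ) (s : Fin (min nr nt)) {r : ℝ}
    {T : ℕ} (hT : 1 ≤ T) (hkT : k s.rev + 1 ≤ T) {M : ℝ → ℕ} (hM : HasMultiplexingGain T M r)
    {δ : ℝ} (hδ : 0 < δ) :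
    ∀ᶠ snr : ℝ in atTop, ∀ (ν : Measure (Block nt T)) (v : NNReal), IsProbabilityMeasure ν →
      snr / 4 ≤ v → ν ≤ (2 : ENNReal) • gaussianBlock nt T v →
      ∫⁻ X : Fin (M snr) → Block nt T, ENNReal.ofReal (errorProb μ X) ∂(Measure.pi fun _ => ν) ≤
        ENNReal.ofReal (snr ^ (-segment k s r + δ)) := by
  obtain ⟨δ₀, hδ₀, h⟩ := eventually_lintegral_le hk hzero htail s r hkT hδ
  have hT0 : (0 : ℝ) < T := by exact_mod_cast hT
  filter_upwards [h, eventually_gt_atTop 1, hM.eventually hT (half_pos hδ₀),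
    eventually_const_mul_rpow_le 2 (show T * (r + δ₀ / 2) < T * (r + δ₀) by
      gcongr; linarith)] with snr h hsnr hMs h2 ν v hν hv hle
  have hs0 : 0 < snr := by linarith
  have hv0 : v ≠ 0 := by
    rintro rfl
    rw [NNReal.coe_zero] at hv
    linarith
  have hMpos : 0 < M snr := lt_of_lt_of_le two_pos (hM.1 snr)
  simp only [ofReal_errorProb μ hMpos]
  rw [lintegral_lintegral_swap (f := fun X H => condError X H)
    measurable_condError_uncurry.aemeasurable]
  refine h _ (Measurable.lintegral_prod_left' (f := fun p : (Fin (M snr) → Block nt T) ×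
    Channel nr nt => condError p.1 p.2) measurable_condError_uncurry) (fun H => ?_) fun H => ?_
  · exact (lintegral_mono fun X => condError_le_one X H).trans (by simp)
  · refine (lintegral_condError_le H hv0 hle).trans ?_
    have hpos : 0 < ∏ l, (1 + snr / 16 * phi H l) :=
      Finset.prod_pos fun l _ => by have := phi_nonneg H l; positivity
    have h3 : ∏ l, (1 + snr / 16 * phi H l) ≤ ∏ l, (1 + v / 4 * phi H l) := by
      refine Finset.prod_le_prod (fun l _ => ?_) fun l _ => ?_
      · have := phi_nonneg H l; positivity
      · have := phi_nonneg H l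
        have : snr / 16 ≤ v / 4 := by linarith
        gcongr
    rw [← ENNReal.ofReal_natCast, ← ENNReal.ofReal_ofNat, ← ENNReal.ofReal_mul (by norm_num),
      ← ENNReal.ofReal_mul (by positivity)]
    refine ENNReal.ofReal_le_ofReal ?_
    calc (M snr : ℝ) * (2 * ((∏ l, (1 + v / 4 * phi H l)) ^ T)⁻¹)
        ≤ snr ^ (T * (r + δ₀ / 2)) * (2 * ((∏ l, (1 + snr / 16 * phi H l)) ^ T)⁻¹) := by
          refine mul_le_mul hMs.2 ?_ (mul_nonneg two_pos.le (inv_nonneg.2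
            (pow_nonneg (hpos.trans_le h3).le _))) (by positivity)
          gcongr
      _ = 2 * snr ^ (T * (r + δ₀ / 2)) * ((∏ l, (1 + snr / 16 * phi H l)) ^ T)⁻¹ := by ring
      _ ≤ _ := by gcongr

/-! ### Outage probability -/

theorem measurableSet_outage {nr nt : ℕ} (r snr : ℝ) :
    MeasurableSet {H : Channel nr nt | Real.logb 2
      (1 + (snr : ℂ) • (Matrix.of H * (Matrix.of H)ᴴ)).det.re < r * Real.logb 2 snr} := by
  have h1 : Continuous fun H : Channel nr nt =>
      (1 + (snr : ℂ) • (Matrix.of H * (Matrix.of H)ᴴ) : Matrix (Fin nr) (Fin nr) ℂ) := by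
    refine continuous_matrix fun i j => ?_
    simp only [Matrix.add_apply, Matrix.smul_apply, Matrix.mul_apply, Matrix.conjTranspose_apply,
      Matrix.of_apply]
    fun_prop
  have h2 := Complex.continuous_re.comp h1.matrix_det
  exact measurableSet_lt (Real.measurable_log.comp h2.measurable |>.div_const _) measurable_const

theorem outage_iff {nr nt : ℕ} {r snr : ℝ} (hsnr : 1 < snr) (H : Channel nr nt) :
    Real.logb 2 (1 + (snr : ℂ) • (Matrix.of H * (Matrix.of H)ᴴ)).det.re < r * Real.logb 2 snr ↔
      ∏ l, (1 + snr * phi H l) < snr ^ r := by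
  have hs0 : 0 < snr := by linarith
  have hpos : 0 < ∏ l, (1 + snr * phi H l) :=
    Finset.prod_pos fun l _ => by have := phi_nonneg H l; positivity
  rw [det_re_eq_prod, ← Real.logb_rpow_eq_mul_logb_of_pos hs0,
    Real.logb_lt_logb_iff one_lt_two hpos (by positivity)]

theorem hasExponent_outageProb {nr nt : ℕ} {μ : Measure (Channel nr nt)}
    [IsProbabilityMeasure μ] {k : Fin (min nr nt) → ℝ} (hk : StrictMono k)
    (hzero : NearZeroBehavior μ k) (htail : ExponentialTails μ) (s : Fin (min nr nt)) {r : ℝ}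
    (hsr : (s : ℝ) ≤ r) (hrs : r < (s : ℝ) + 1) (hr : 0 < r) :
    HasExponent (outageProb μ r) (segment k s r) := by
  refine hasExponent_of_bounds (fun δ hδ => ?_) fun δ hδ => ?_
  · obtain ⟨α, hα, hsum, hαr⟩ := exists_scale k s hsr hrs (half_pos hδ)
    have hS : ∑ l, max (1 - α l) 0 < r := by
      rcases hαr with h | h
      · exact h.2
      · exact absurd h.1 hr.ne'
    filter_upwards [eventually_gt_atTop 1, (hzero α hα).eventually_rpow_le (half_pos hδ),
      eventually_const_mul_rpow_le (2 ^ (min nr nt) * 2) hS] with snr hsnr h1 h2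
    have hs0 : 0 < snr := by linarith
    refine (Real.rpow_le_rpow_of_exponent_le hsnr.le (by linarith)).trans
      (h1.trans (measureReal_mono fun H hH => ?_))
    refine (outage_iff hsnr H).2 ?_
    have hpow : 0 < 2 ^ (min nr nt) * snr ^ ∑ l, max (1 - α l) 0 := by positivity
    calc ∏ l, (1 + snr * phi H l) ≤ ∏ l, 2 * snr ^ (max (1 - α l) 0) := by
          refine Finset.prod_le_prod (fun l _ => ?_) fun l _ => ?_
          · have := phi_nonneg H l; positivity
          · have h3 : 1 ≤ snr ^ (max (1 - α l) 0) := Real.one_le_rpow hsnr.le (le_max_right _ _)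
            have h4 : snr * phi H l ≤ snr ^ (max (1 - α l) 0) := by
              calc _ ≤ snr * snr ^ (-α l) := by gcongr; exact hH l
                _ = snr ^ (1 - α l) := by
                  nth_rewrite 1 [← Real.rpow_one snr]
                  rw [← Real.rpow_add hs0]; rfl
                _ ≤ _ := Real.rpow_le_rpow_of_exponent_le hsnr.le (le_max_left _ _)
            linarith
      _ = 2 ^ (min nr nt) * snr ^ ∑ l, max (1 - α l) 0 := by
          rw [Finset.prod_mul_distrib, Finset.prod_const, Finset.card_univ, Fintype.card_fin,
            ← Real.rpow_sum_of_pos hs0]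
      _ < 2 ^ (min nr nt) * 2 * snr ^ ∑ l, max (1 - α l) 0 := by linarith
      _ ≤ snr ^ r := h2
  -- In outage `snr ^ r / ∏ (1 + snr φ_l / 16)` exceeds one, hence so does any power of it; the
  -- power `τ` is thus free.
  · obtain ⟨τ, hτ⟩ := exists_nat_ge (k s.rev + 1)
    obtain ⟨δ₀, hδ₀, h⟩ := eventually_lintegral_le hk hzero htail s r hτ hδ
    filter_upwards [h, eventually_gt_atTop 1] with snr h hsnr
    have hs0 : 0 < snr := by linarith
    have hm := measurableSet_outage (nr := nr) (nt := nt) r snr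
    have h1 := h _ ((measurable_const (a := (1 : ENNReal))).indicator hm)
      (fun H => Set.indicator_le_self' (fun _ _ => zero_le_one) H) fun H => ?_
    · rw [lintegral_indicator_const hm, one_mul, ← ofReal_measureReal,
        ENNReal.ofReal_le_ofReal_iff (by positivity)] at h1
      exact h1
    · refine Set.indicator_apply_le' (fun hH => ?_) fun _ => zero_le
      have h2 := (outage_iff hsnr H).1 hH
      have hpos : 0 < ∏ l, (1 + snr / 16 * phi H l) :=
        Finset.prod_pos fun l _ => by have := phi_nonneg H l; positivity
      have h3 : ∏ l, (1 + snr / 16 * phi H l) ≤ ∏ l, (1 + snr * phi H l) := by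
        refine Finset.prod_le_prod (fun l _ => ?_) fun l _ => ?_
        · have := phi_nonneg H l; positivity
        · have := phi_nonneg H l
          gcongr
          linarith
      rw [← ENNReal.ofReal_one]
      refine ENNReal.ofReal_le_ofReal ?_
      rw [← div_eq_mul_inv, one_le_div (by positivity)]
      calc (∏ l, (1 + snr / 16 * phi H l)) ^ τ ≤ (snr ^ r) ^ τ :=
            pow_le_pow_left₀ hpos.le (h3.trans h2.le) τ
        _ = snr ^ (τ * r) := by rw [← Real.rpow_natCast, ← Real.rpow_mul hs0.le, mul_comm]
        _ ≤ _ := Real.rpow_le_rpow_of_exponent_le hsnr.le (by gcongr; linarith)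

/-! ### Gaussian ensembles -/

/-- There are polynomially many codewords, and each exceeds the energy with probability of order
`exp (-snr ^ η / 2)`; a union bound concludes. -/
theorem eventually_half_le_measure_energy {nt T : ℕ} (hT : 1 ≤ T) {M : ℝ → ℕ} {r : ℝ}
    (hM : HasMultiplexingGain T M r) {η : ℝ} (hη : 0 < η) :
    ∀ᶠ snr : ℝ in atTop, ENNReal.ofReal (1 / 2) ≤
      (Measure.pi fun _ : Fin (M snr) => gaussianBlock nt T snr.toNNReal)
        {X | ∀ i, energy (X i) ≤ snr ^ (1 + η)} := by
  filter_upwards [eventually_gt_atTop 1, hM.eventually hT one_pos,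
    eventually_exp_neg_mul_rpow_le (2 * 2 ^ (nt * T)) (show (0 : ℝ) < 1 / 2 by norm_num) hη
      (-(T * (r + 1)))] with snr hsnr hMs h1
  have hs0 : 0 < snr := by linarith
  have hv : snr.toNNReal ≠ 0 := by simpa using hs0
  have hvc : (snr.toNNReal : ℝ) = snr := Real.coe_toNNReal _ hs0.le
  set P := Measure.pi fun _ : Fin (M snr) => gaussianBlock nt T snr.toNNReal with hP
  have hm : MeasurableSet {X : Fin (M snr) → Block nt T | ∀ i, energy (X i) ≤ snr ^ (1 + η)} := by
    rw [Set.ofPred_forall]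
    exact MeasurableSet.iInter fun i => measurableSet_le
      (measurable_energy.comp (measurable_pi_apply i)) measurable_const
  have h2 : P {X | ∀ i, energy (X i) ≤ snr ^ (1 + η)}ᶜ ≤ ENNReal.ofReal (1 / 2) := by
    have hsub : {X : Fin (M snr) → Block nt T | ∀ i, energy (X i) ≤ snr ^ (1 + η)}ᶜ ⊆
        ⋃ i ∈ Finset.univ, {X | snr ^ (1 + η) ≤ energy (X i)} := by
      intro X hX
      have hX' : ¬ ∀ i, energy (X i) ≤ snr ^ (1 + η) := hX
      push Not at hX'
      obtain ⟨i, hi⟩ := hX'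
      simp only [Set.mem_iUnion]
      exact ⟨i, Finset.mem_univ i, hi.le⟩
    have h3 : ∀ i ∈ (Finset.univ : Finset (Fin (M snr))), P {X | snr ^ (1 + η) ≤ energy (X i)} ≤
        ENNReal.ofReal (2 ^ (nt * T) * Real.exp (-(1 / 2 * snr ^ η))) := by
      intro i _
      have h4 := (measurePreserving_eval (fun _ : Fin (M snr) =>
        gaussianBlock nt T snr.toNNReal) i).measure_preimage
        (measurableSet_le measurable_const measurable_energy :
          MeasurableSet {W : Block nt T | snr ^ (1 + η) ≤ energy W}).nullMeasurableSet
      refine h4.le.trans ((gaussianBlock_energy_tail hv _).trans (le_of_eq ?_))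
      rw [hvc, Real.rpow_add hs0, Real.rpow_one]
      congr 3
      field_simp
    refine (measure_mono hsub).trans ((measure_biUnion_finset_le _ _).trans
      ((Finset.sum_le_card_nsmul _ _ _ h3).trans ?_))
    rw [nsmul_eq_mul, Finset.card_univ, Fintype.card_fin, ← ENNReal.ofReal_natCast,
      ← ENNReal.ofReal_mul (by positivity)]
    refine ENNReal.ofReal_le_ofReal ?_
    calc (M snr : ℝ) * (2 ^ (nt * T) * Real.exp (-(1 / 2 * snr ^ η)))
        ≤ snr ^ (T * (r + 1)) * (1 / 2 * snr ^ (-(T * (r + 1)))) := by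
          refine mul_le_mul hMs.2 (by linarith) (by positivity) (by positivity)
      _ = 1 / 2 := by
          rw [mul_left_comm, ← Real.rpow_add hs0, add_neg_cancel, Real.rpow_zero, mul_one]
  have h5 := prob_add_prob_compl (μ := P) hm
  by_contra hlt
  rw [not_le] at hlt
  have h6 := ENNReal.add_lt_add_of_lt_of_le (ne_top_of_le_ne_top ENNReal.ofReal_ne_top h2) hlt h2
  rw [h5, ← ENNReal.ofReal_add (by norm_num) (by norm_num)] at h6
  norm_num at h6

theorem ofReal_gaussianCodeErrorProb {nr nt : ℕ} (μ : Measure (Channel nr nt))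
    [IsProbabilityMeasure μ] {T M : ℕ} (hM : 0 < M) (snr : ℝ) :
    ENNReal.ofReal (gaussianCodeErrorProb μ T M snr) =
      ∫⁻ X : Fin M → Block nt T, ENNReal.ofReal (errorProb μ X)
        ∂(Measure.pi fun _ => gaussianBlock nt T snr.toNNReal) := by
  unfold gaussianCodeErrorProb
  have h1 : (fun X : Fin M → Block nt T => errorProb μ X) =
      fun X => (∫⁻ H, condError X H ∂μ).toReal := by
    ext X
    rw [← ofReal_errorProb μ hM, ENNReal.toReal_ofReal (errorProb_nonneg μ X)]
  have hmeas : Measurable fun X : Fin M → Block nt T => errorProb μ X := by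
    rw [h1]
    exact (measurable_lintegral_condError μ).ennreal_toReal
  refine ofReal_integral_eq_lintegral_ofReal ?_ (Eventually.of_forall fun X => errorProb_nonneg μ X)
  refine Integrable.of_bound hmeas.aestronglyMeasurable 1 (Eventually.of_forall fun X => ?_)
  rw [Real.norm_eq_abs, abs_of_nonneg (errorProb_nonneg μ X), ← ENNReal.ofReal_le_one,
    ofReal_errorProb μ hM]
  exact (lintegral_mono fun H => condError_le_one X H).trans (by simp)

theorem gaussianCodeErrorProb_nonneg {nr nt : ℕ} (μ : Measure (Channel nr nt)) (T M : ℕ)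
    (snr : ℝ) : 0 ≤ gaussianCodeErrorProb μ T M snr :=
  integral_nonneg fun X => errorProb_nonneg μ X

theorem hasExponent_gaussianCodeErrorProb {nr nt : ℕ} {μ : Measure (Channel nr nt)}
    [IsProbabilityMeasure μ] {k : Fin (min nr nt) → ℝ} (hk : StrictMono k)
    (hzero : NearZeroBehavior μ k) (htail : ExponentialTails μ) (s : Fin (min nr nt)) {r : ℝ}
    (hsr : (s : ℝ) ≤ r) (hrs : r < (s : ℝ) + 1) {T : ℕ} (hT : 1 ≤ T) (hkT : k s.rev + 1 ≤ T)
    {M : ℝ → ℕ} (hM : HasMultiplexingGain T M r) :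
    HasExponent (fun snr => gaussianCodeErrorProb μ T (M snr) snr) (segment k s r) := by
  have hMpos : ∀ snr, 0 < M snr := fun snr => lt_of_lt_of_le two_pos (hM.1 snr)
  refine hasExponent_of_bounds (fun δ hδ => ?_) fun δ hδ => ?_
  · obtain ⟨η, hη, h⟩ := eventually_rpow_le_errorProb hzero s hsr hrs hT (half_pos hδ)
    filter_upwards [h, hM.eventually hT hη, eventually_half_le_measure_energy (nt := nt) hT hM hη,
      eventually_gt_atTop 1, eventually_const_mul_rpow_le 2
        (show -segment k s r - δ < -segment k s r - δ / 2 by linarith)]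
      with snr h hMs h2 hsnr h3
    have hs0 : 0 < snr := by linarith
    have hmeas : Measurable fun X : Fin (M snr) → Block nt T => ENNReal.ofReal (errorProb μ X) := by
      simp only [ofReal_errorProb μ (hMpos snr)]
      exact measurable_lintegral_condError μ
    -- The converse applies to the codes of energy at most `snr ^ (1 + η)`, which make up at least
    -- half of the ensemble.
    have h4 := mul_measure_le_lintegral
      (μ := Measure.pi fun _ : Fin (M snr) => gaussianBlock nt T snr.toNNReal) hmeas
      (B := {X | ∀ i, energy (X i) ≤ snr ^ (1 + η)}) fun X hX =>
        ENNReal.ofReal_le_ofReal (h (M snr) X (hM.1 snr) hMs.1 hX)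
    rw [← ofReal_gaussianCodeErrorProb μ (hMpos snr)] at h4
    have h5 := (mul_le_mul_right h2 (ENNReal.ofReal (snr ^ (-segment k s r - δ / 2)))).trans h4
    rw [← ENNReal.ofReal_mul (by positivity),
      ENNReal.ofReal_le_ofReal_iff (gaussianCodeErrorProb_nonneg _ _ _ _)] at h5
    linarith
  · filter_upwards [eventually_lintegral_errorProb_le hk hzero htail s hT hkT hM hδ,
      eventually_gt_atTop 1] with snr h hsnr
    have hs0 : 0 < snr := by linarith
    have h1 := h (gaussianBlock nt T snr.toNNReal) snr.toNNReal inferInstance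
      (by rw [Real.coe_toNNReal _ hs0.le]; linarith) (by
        rw [two_smul]; exact Measure.le_add_left le_rfl)
    rw [← ofReal_gaussianCodeErrorProb μ (hMpos snr),
      ENNReal.ofReal_le_ofReal_iff (by positivity)] at h1
    exact h1

/-! ### Codes under the power constraint -/

/-- The Gaussian ensemble conditioned on the power constraint. -/
theorem exists_constrained_ensemble {nt T : ℕ} (hnt : 1 ≤ nt) (hT : 1 ≤ T) {snr : ℝ}
    (hsnr : 0 < snr) :
    ∃ ν : Measure (Block nt T), IsProbabilityMeasure ν ∧
      ν ≤ (2 : ENNReal) • gaussianBlock nt T (snr / 4).toNNReal ∧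
      ν {X | ¬ energy X ≤ T * nt * snr} = 0 := by
  -- With this variance the tail bound at the power limit is `(2 exp (-2)) ^ (nt T) ≤ 1/2`, so
  -- conditioning at most doubles the law.
  set v := (snr / 4).toNNReal with hv
  have hv0 : v ≠ 0 := by simpa [hv] using hsnr
  have hvc : (v : ℝ) = snr / 4 := Real.coe_toNNReal _ (by positivity)
  set γ := gaussianBlock nt T v with hγ
  set A : Set (Block nt T) := {X | energy X ≤ T * nt * snr} with hA
  have hAm : MeasurableSet A := measurableSet_le measurable_energy measurable_const
  have h1 : γ Aᶜ ≤ ENNReal.ofReal (1 / 2) := by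
    have hsub : Aᶜ ⊆ {X | T * nt * snr ≤ energy X} := fun X hX =>
      (not_le.1 (show ¬ energy X ≤ T * nt * snr from hX)).le
    refine (measure_mono hsub).trans ((gaussianBlock_energy_tail hv0 _).trans
      (ENNReal.ofReal_le_ofReal ?_))
    have h2 : -(T * nt * snr) / (2 * v) = ((nt * T : ℕ) : ℝ) * (-2) := by
      rw [hvc]; push_cast; field_simp; norm_num
    have h3 : Real.exp (-2) ≤ 1 / 4 := by
      rw [Real.exp_neg, ← one_div]
      have h4 : (2 : ℝ) ≤ Real.exp 1 := by linarith [Real.add_one_le_exp (1 : ℝ)]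
      have h5 : Real.exp 2 = Real.exp 1 * Real.exp 1 := by rw [← Real.exp_add]; norm_num
      refine one_div_le_one_div_of_le (by norm_num) ?_
      nlinarith
    rw [h2, Real.exp_nat_mul, ← mul_pow]
    have h6 : 0 < Real.exp (-2) := Real.exp_pos _
    calc (2 * Real.exp (-2)) ^ (nt * T) ≤ (1 / 2) ^ (nt * T) := by gcongr; linarith
      _ ≤ (1 / 2) ^ 1 := pow_le_pow_of_le_one (by norm_num) (by norm_num)
          (Nat.one_le_iff_ne_zero.2 (Nat.mul_ne_zero (by omega) (by omega)))
      _ = 1 / 2 := pow_one _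
  have h2 : (2 : ENNReal)⁻¹ ≤ γ A := by
    by_contra hlt
    rw [not_le] at hlt
    have h3 := ENNReal.add_lt_add_of_lt_of_le (ne_top_of_le_ne_top ENNReal.ofReal_ne_top h1) hlt h1
    rw [prob_add_prob_compl hAm, one_div, ENNReal.ofReal_inv_of_pos two_pos,
      ENNReal.ofReal_ofNat, ENNReal.inv_two_add_inv_two] at h3
    exact lt_irrefl _ h3
  have h3 : γ A ≠ 0 := fun h => by simp [h] at h2
  refine ⟨cond γ A, cond_isProbabilityMeasure h3, ?_, ?_⟩
  · have h4 : (γ A)⁻¹ ≤ 2 := by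
      rw [ENNReal.inv_le_iff_inv_le]; exact h2
    refine Measure.le_iff.2 fun B hB => ?_
    rw [cond_apply hAm, Measure.smul_apply, smul_eq_mul]
    exact mul_le_mul' h4 (measure_mono Set.inter_subset_right)
  · rw [cond_apply hAm]
    have : A ∩ {X | ¬ energy X ≤ T * nt * snr} = ∅ := by
      ext X
      simp [hA]
    rw [this, measure_empty, mul_zero]

theorem exists_constrained_code {nr nt T M : ℕ} (hT : 1 ≤ T) (hnt : 1 ≤ nt) (hM : 0 < M)
    (μ : Measure (Channel nr nt)) [IsProbabilityMeasure μ] (snr : ℝ) :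
    ∃ X : Fin M → Block nt T, 0 < snr → (∀ i, energy (X i) ≤ T * nt * snr) ∧
      ∃ ν : Measure (Block nt T), IsProbabilityMeasure ν ∧
        ν ≤ (2 : ENNReal) • gaussianBlock nt T (snr / 4).toNNReal ∧
        ENNReal.ofReal (errorProb μ X) ≤
          ∫⁻ X : Fin M → Block nt T, ENNReal.ofReal (errorProb μ X) ∂(Measure.pi fun _ => ν) := by
  by_cases hsnr : 0 < snr
  swap
  -- A code is needed for every real `snr`; for `snr ≤ 0` any value does.
  · exact ⟨0, fun h => absurd h hsnr⟩
  obtain ⟨ν, hν, hle, h0⟩ := exists_constrained_ensemble hnt hT hsnr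
  have hmeas : Measurable fun X : Fin M → Block nt T => ENNReal.ofReal (errorProb μ X) := by
    simp only [ofReal_errorProb μ hM]
    exact measurable_lintegral_condError μ
  have hnull : (Measure.pi fun _ : Fin M => ν) {X | ¬ ∀ i, energy (X i) ≤ T * nt * snr} = 0 := by
    have h1 : {X : Fin M → Block nt T | ¬ ∀ i, energy (X i) ≤ T * nt * snr} ⊆
        ⋃ i, (fun X => X i) ⁻¹' {X | ¬ energy X ≤ T * nt * snr} := by
      intro X hX
      have hX' : ¬ ∀ i, energy (X i) ≤ T * nt * snr := hX
      push Not at hX'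
      obtain ⟨i, hi⟩ := hX'
      exact Set.mem_iUnion.2 ⟨i, not_le.2 hi⟩
    refine measure_mono_null h1 (measure_iUnion_null fun i => ?_)
    exact (measurePreserving_eval (fun _ : Fin M => ν) i).quasiMeasurePreserving.preimage_null h0
  -- Some code outside the null set of violations has an error no larger than the mean.
  obtain ⟨X, hX, hle'⟩ := exists_notMem_null_le_lintegral hmeas.aemeasurable hnull
  exact ⟨X, fun _ => ⟨not_not.1 hX, ν, hν, hle, hle'⟩⟩

theorem exists_hasMultiplexingGain {T : ℕ} (hT : 1 ≤ T) {r : ℝ} (hr : 0 ≤ r) :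
    ∃ M : ℝ → ℕ, HasMultiplexingGain T M r := by
  have hT0 : (0 : ℝ) < T := by exact_mod_cast hT
  -- Adding 2 guarantees two codewords for every `snr` and does not affect the exponent.
  refine ⟨fun snr => ⌊snr ^ (T * r)⌋₊ + 2, fun snr => Nat.le_add_left _ _, ?_⟩
  have h : HasExponent (fun snr : ℝ => ((⌊snr ^ (T * r)⌋₊ + 2 : ℕ) : ℝ)) (-(T * r)) := by
    refine hasExponent_of_bounds (fun δ hδ => ?_) fun δ hδ => ?_
    · filter_upwards [eventually_gt_atTop 1] with snr hsnr
      have h1 := Nat.lt_floor_add_one (snr ^ (T * r))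
      have h2 : snr ^ (- -(T * r) - δ) ≤ snr ^ (T * r) :=
        Real.rpow_le_rpow_of_exponent_le hsnr.le (by linarith)
      push_cast
      linarith
    · filter_upwards [eventually_gt_atTop 1, eventually_const_mul_rpow_le 3
        (show T * r < - -(T * r) + δ by linarith)] with snr hsnr h3
      have hs0 : 0 < snr := by linarith
      have h1 := Nat.floor_le (show 0 ≤ snr ^ (T * r) by positivity)
      have h2 : 1 ≤ snr ^ (T * r) := Real.one_le_rpow hsnr.le (by positivity)
      push_cast
      linarith
  have h1 := h.2.div_const (T : ℝ)
  rw [neg_neg, mul_div_cancel_left₀ _ hT0.ne'] at h1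
  refine h1.congr fun snr => ?_
  rw [div_right_comm]

theorem eventually_power_le {nt T : ℕ} {η : ℝ} (hη : 0 < η) :
    ∀ᶠ snr : ℝ in atTop, T * nt * snr ≤ snr ^ (1 + η) := by
  filter_upwards [eventually_const_mul_rpow_le (T * nt) (show (1 : ℝ) < 1 + η by linarith)]
    with snr h
  rwa [Real.rpow_one] at h

theorem Supports.le_segment {nr nt : ℕ} {μ : Measure (Channel nr nt)}
    [IsProbabilityMeasure μ] {k : Fin (min nr nt) → ℝ} (hzero : NearZeroBehavior μ k)
    (s : Fin (min nr nt)) {r : ℝ} (hsr : (s : ℝ) ≤ r) (hrs : r < (s : ℝ) + 1) {T : ℕ}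
    (hT : 1 ≤ T) {d : ℝ} (h : Supports μ T r d) : d ≤ segment k s r := by
  obtain ⟨M, X, hM, hX, hd⟩ := h
  refine hd.le_of_eventually_rpow_le fun δ hδ => ?_
  obtain ⟨η, hη, h⟩ := eventually_rpow_le_errorProb hzero s hsr hrs hT hδ
  filter_upwards [h, hM.eventually hT hη, eventually_power_le (nt := nt) (T := T) hη,
    eventually_gt_atTop 0] with snr h hMs hp hs0
  exact h (M snr) (X snr) (hM.1 snr) hMs.1 fun i => (hX snr hs0 i).trans hp

theorem supports_segment {nr nt : ℕ} {μ : Measure (Channel nr nt)}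
    [IsProbabilityMeasure μ] {k : Fin (min nr nt) → ℝ} (hk : StrictMono k)
    (hzero : NearZeroBehavior μ k) (htail : ExponentialTails μ) (s : Fin (min nr nt)) {r : ℝ}
    (hsr : (s : ℝ) ≤ r) (hrs : r < (s : ℝ) + 1) {T : ℕ} (hT : 1 ≤ T) (hkT : k s.rev + 1 ≤ T) :
    Supports μ T r (segment k s r) := by
  obtain ⟨M, hM⟩ := exists_hasMultiplexingGain hT ((Nat.cast_nonneg _).trans hsr)
  have hMpos : ∀ snr, 0 < M snr := fun snr => lt_of_lt_of_le two_pos (hM.1 snr)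
  have hnt : 1 ≤ nt := (Nat.succ_le_of_lt s.pos).trans (min_le_right _ _)
  choose X hX using fun snr => exists_constrained_code hT hnt (hMpos snr) μ snr
  refine ⟨M, X, hM, fun snr h => (hX snr h).1, ?_⟩
  refine hasExponent_of_bounds (fun δ hδ => ?_) fun δ hδ => ?_
  · obtain ⟨η, hη, h⟩ := eventually_rpow_le_errorProb hzero s hsr hrs hT hδ
    filter_upwards [h, hM.eventually hT hη, eventually_power_le (nt := nt) (T := T) hη,
      eventually_gt_atTop 0] with snr h hMs hp hs0
    exact h (M snr) (X snr) (hM.1 snr) hMs.1 fun i => ((hX snr hs0).1 i).trans hp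
  · filter_upwards [eventually_lintegral_errorProb_le hk hzero htail s hT hkT hM hδ,
      eventually_gt_atTop 0] with snr h hs0
    obtain ⟨-, ν, hν, hle, h1⟩ := hX snr hs0
    have h2 := h1.trans (h ν _ hν (by rw [Real.coe_toNNReal _ (by positivity)]) hle)
    rwa [ENNReal.ofReal_le_ofReal_iff (by positivity)] at h2

end MIMO

theorem theorem6 (nr nt : ℕ) (μ : MeasureTheory.Measure (MIMO.Channel nr nt))
    [MeasureTheory.IsProbabilityMeasure μ] (k : Fin (min nr nt) → ℝ) (hk : StrictMono k)
    (hzero : MIMO.NearZeroBehavior μ k) (htail : MIMO.ExponentialTails μ)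
    (s : Fin (min nr nt)) (r : ℝ) (hsr : (s : ℝ) ≤ r) (hrs : r < (s : ℝ) + 1) :
    (0 < r → MIMO.HasExponent (MIMO.outageProb μ r) (MIMO.segment k s r)) ∧
    IsGreatest {d : ℝ | ∃ T : ℕ, 1 ≤ T ∧ MIMO.Supports μ T r d} (MIMO.segment k s r) ∧
    ∀ T : ℕ, 1 ≤ T → k s.rev + 1 ≤ T →
      MIMO.Supports μ T r (MIMO.segment k s r) ∧
      ∀ M : ℝ → ℕ, MIMO.HasMultiplexingGain T M r →
        MIMO.HasExponent (fun snr => MIMO.gaussianCodeErrorProb μ T (M snr) snr)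
          (MIMO.segment k s r) := by
  refine ⟨MIMO.hasExponent_outageProb hk hzero htail s hsr hrs, ⟨?_, ?_⟩, fun T hT hkT =>
    ⟨MIMO.supports_segment hk hzero htail s hsr hrs hT hkT, fun M hM =>
      MIMO.hasExponent_gaussianCodeErrorProb hk hzero htail s hsr hrs hT hkT hM⟩⟩
  · obtain ⟨T, hT⟩ := exists_nat_ge (max 1 (k s.rev + 1))
    have hT1 : 1 ≤ T := by exact_mod_cast (le_max_left _ _).trans hT
    exact ⟨T, hT1, MIMO.supports_segment hk hzero htail s hsr hrs hT1
      ((le_max_right _ _).trans hT)⟩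
  · rintro d ⟨T, hT, h⟩
    exact h.le_segment hzero s hsr hrs hT
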